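/- **Setting.** Let $A=(a_{ij})\in\mathbb R^{n\times n}$ be symmetric with non-negative entries, and let $G$ be the similarity graph on $[n]$ in which distinct $i,j$ are incident iff $a_{ij}>0$. Let $L=\operatorname{diag}\big(\sum_j a_{ij}\big)_i-A$ be its unnormalized Laplacian. Suppose that $G$ has exactly $m$ connected components $\mathcal S_1,\dots,\mathcal S_m$, with $m<n$. Put $w_j=|\mathcal S_j|/n$, $w_{\min}=\min_j w_j$, $w_{\max}=\max_j w_j$. For a real symmetric matrix $M$ let $\lambda_1(M)\le\dots\le\lambda_n(M)$ be its eigenvalues with multiplicity, and let $\delta(L)=\lambda_{m+1}(L)-\lambda_m(L)$. Let $H\in\mathbb R^{n\times n}$ be symmetric and $\tilde L=L+H$. Matrix norms are spectral norms, vector norms are Euclidean, and $S^{m-1}$ is the unit sphere of $\mathbb R^m$. The rows of a matrix $X$ are denoted $x_{i\cdot}$ and its columns $x_{\cdot j}$. Let $c_{\min},c_{\max},D>0$. A function $g:[0,\infty)\to\mathbb R$ that is continuous on $[0,\infty)$ and twice continuously differentiable on $(0,\infty)$ is a *$(c_{\min},c_{\max},D)$-robust contrast* if the right derivative of $x\mapsto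 g(\sqrt x)$ at $0$ is $0$ or $-\infty$, and the function $h:\mathbb R\to\mathbb R$, $h(t)=g(\sqrt{|t|})$, is three times differentiable on $\mathbb R$ with $c_{\min}\le h''(x)\le c_{\max}$ and $|h'''(x)|<D$ for every $x\in\mathbb R$. **Theorem.** For every $E>0$ there is a constant $C>0$, depending only on $E$, such that the following holds for all $n$, $m$, $A$, $H$ as above. Let $\tilde X\in\mathbb R^{n\times m}$ have pairwise orthogonal columns with $\|\tilde x_{\cdot j}\|=\sqrt n$ and $\tilde L\tilde x_{\cdot j}=\lambda_j(\tilde L)\tilde x_{\cdot j}$ for $j\in[m]$. Let the columns of $X\in\mathbb R^{n\times m}$ form an orthogonal basis of the null space of $L$ with $\|x_{\cdot j}\|=\sqrt n$, such that $$\frac1{\sqrt n}\|X-\tilde X\|\le\frac{2\|H\|}{\delta(L)-\|H\|}.$$ Let $g$ be a $(c_{\min},c_{\max},D)$-robust contrast, and let $\tilde F_g(u)=\frac1n\sum_{i=1}^n g(|\langle u,\tilde x_{i\cdot}\rangle|)$. Let $Z_1,\dots,Z_m\in\mathbb R^m$ be the distinct vectors among $x_{i\cdot}/\|x_{i\cdot}\|$,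 $i\in[n]$. If $$\|H\|\le\delta(L)\,\min\Big(\frac{E}{\sqrt n},\ \frac{w_{\min}^{11/2}\,c_{\min}^2}{2048\,w_{\max}^5\,c_{\max}(1+E)^3},\ \frac12\Big),$$ then, with $$\rho=C\Big(\frac{\|H\|}{\delta(L)}\Big)^{1/3}\sqrt{\frac{(c_{\max}+D)\,m}{c_{\min}}\cdot\frac{w_{\max}^2}{w_{\min}^{7/2}}},$$ the following hold. 1. (Maxima existence) For every $i\in[m]$ and $s\in\{\pm1\}$ there is a local maximum $v$ of $\tilde F_g$ with respect to $S^{m-1}$ such that $\|sZ_i-v\|\le\rho$. 2. (No spurious maxima) If $v$ is a local maximum of $\tilde F_g$ with respect to $S^{m-1}$, then there are $i\in[m]$ and $s\in\{\pm1\}$ such that $\|sZ_i-v\|\le\rho$. -/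

import Mathlib

open Real Set Filter Topology
open scoped Matrix Matrix.Norms.L2Operator

noncomputable section

/-- A similarity graph on the vertices `0, …, n - 1`: a symmetric adjacency matrix with
non-negative weights. -/
structure SimilarityGraph (n : ℕ) where
  /-- the adjacency matrix `A = (a_{ij})` -/
  weight : Matrix (Fin n) (Fin n) ℝ
  symm : weight.IsSymm
  nonneg : ∀ i j, 0 ≤ weight i j

namespace SimilarityGraph

variable {n : ℕ} (G : SimilarityGraph n)

/-- The underlying graph: two distinct vertices are incident if and only if `a_{ij} > 0`.
(Self-loops affect neither the connected components nor the Laplacian.) -/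
def graph : SimpleGraph (Fin n) where
  Adj i j := i ≠ j ∧ 0 < G.weight i j
  symm := ⟨fun i j h => ⟨h.1.symm, by rw [G.symm.apply i j]; exact h.2⟩⟩
  loopless := ⟨fun _ h => h.1 rfl⟩

/-- The unnormalized Laplacian `L = diag(∑ⱼ a_{ij}) - A`. -/
def laplacian : Matrix (Fin n) (Fin n) ℝ :=
  Matrix.diagonal (fun i => ∑ j, G.weight i j) - G.weight

theorem laplacian_isHermitian : G.laplacian.IsHermitian := by
  have h : G.weight.IsHermitian := by
    rw [Matrix.IsHermitian, Matrix.conjTranspose_eq_transpose_of_trivial]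
    exact G.symm
  exact (Matrix.isHermitian_diagonal _).sub h

/-- The weight `w_c = |S_c| / n` of a connected component `c` with vertex set `S_c`. -/
def componentWeight (c : G.graph.ConnectedComponent) : ℝ :=
  (Nat.card c.supp : ℝ) / n

/-- The smallest component weight `w_min`. -/
def wMin : ℝ := ⨅ c, G.componentWeight c

/-- The largest component weight `w_max`. -/
def wMax : ℝ := ⨆ c, G.componentWeight c

end SimilarityGraph

/-- The eigenvalues of a real symmetric `n × n` matrix, with multiplicity and in increasing
order: `ascEigenvalue hM k` is `λ_{k+1}(M)` for `k = 0, …, n - 1`.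
(Mathlib's `eigenvalues₀` lists them in decreasing order.) -/
def ascEigenvalue {n : ℕ} {M : Matrix (Fin n) (Fin n) ℝ} (hM : M.IsHermitian) (k : Fin n) : ℝ :=
  hM.eigenvalues₀ (Fin.cast (Fintype.card_fin n).symm k.rev)

/-- The eigengap `δ(L) = λ_{m+1}(L) - λ_m(L)` of the graph Laplacian. -/
def SimilarityGraph.eigengap {n : ℕ} (G : SimilarityGraph n) (m : ℕ) (hmn : m < n) : ℝ :=
  ascEigenvalue G.laplacian_isHermitian ⟨m, hmn⟩ -
    ascEigenvalue G.laplacian_isHermitian ⟨m - 1, (Nat.sub_le m 1).trans_lt hmn⟩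

/-- The columns of `X` are pairwise orthogonal and each has Euclidean norm `√n`. -/
def HasScaledOrthogonalColumns {n m : ℕ} (X : Matrix (Fin n) (Fin m) ℝ) : Prop :=
  Xᵀ * X = (n : ℝ) • (1 : Matrix (Fin m) (Fin m) ℝ)

/-- The columns of `X` form a scaled orthogonal basis (each of norm `√n`) of the null space
of `L`. -/
def IsScaledNullBasis {n m : ℕ} (L : Matrix (Fin n) (Fin n) ℝ) (X : Matrix (Fin n) (Fin m) ℝ) :
    Prop :=
  HasScaledOrthogonalColumns X ∧
    Submodule.span ℝ (Set.range fun j => X.col j) = LinearMap.ker L.mulVecLin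

/-- The columns of `X` are the lowest `m` eigenvectors of the symmetric matrix `M`: they are
orthogonal, scaled to norm `√n`, and the `j`-th one belongs to the `j`-th smallest eigenvalue. -/
def IsLowestEigenvectors {n m : ℕ} (hmn : m ≤ n) {M : Matrix (Fin n) (Fin n) ℝ}
    (hM : M.IsHermitian) (X : Matrix (Fin n) (Fin m) ℝ) : Prop :=
  HasScaledOrthogonalColumns X ∧
    ∀ j : Fin m, M *ᵥ X.col j = ascEigenvalue hM (Fin.castLE hmn j) • X.col j

/-- The embedded point `x_{i·} ∈ ℝᵐ`: the `i`-th row of `X`. -/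
def embeddedPoint {n m : ℕ} (X : Matrix (Fin n) (Fin m) ℝ) (i : Fin n) :
    EuclideanSpace ℝ (Fin m) :=
  WithLp.toLp 2 (X.row i)

/-- `F_g(u) = (1/n) ∑ᵢ g(|⟨u, x_{i·}⟩|)`. -/
def contrastFun {n m : ℕ} (g : ℝ → ℝ) (X : Matrix (Fin n) (Fin m) ℝ)
    (u : EuclideanSpace ℝ (Fin m)) : ℝ :=
  (1 / (n : ℝ)) * ∑ i, g |inner ℝ u (embeddedPoint X i)|

/-- `v` is a local maximum of `F` with respect to the unit sphere. -/
def IsSphereLocalMax {m : ℕ} (F : EuclideanSpace ℝ (Fin m) → ℝ)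
    (v : EuclideanSpace ℝ (Fin m)) : Prop :=
  v ∈ Metric.sphere (0 : EuclideanSpace ℝ (Fin m)) 1 ∧
    IsLocalMaxOn F (Metric.sphere (0 : EuclideanSpace ℝ (Fin m)) 1) v

/-- A `(cmin, cmax, D)`-robust contrast `g : [0, ∞) → ℝ` (only the values of `g` on `[0, ∞)`
matter). -/
structure IsRobustContrast (cmin cmax D : ℝ) (g : ℝ → ℝ) : Prop where
  cmin_pos : 0 < cmin
  cmax_pos : 0 < cmax
  D_pos : 0 < D
  continuousOn : ContinuousOn g (Ici 0)
  contDiffOn : ContDiffOn ℝ 2 g (Ioi 0)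
  /-- the right derivative of `g(√x)` at the origin is `0` or `-∞` -/
  right_deriv : HasDerivWithinAt (fun x => g (√x)) 0 (Ici 0) 0 ∨
    Tendsto (fun x => (g (√x) - g 0) / x) (𝓝[>] 0) atBot
  /-- `g(√|t|)` is three times differentiable on the whole line -/
  differentiable : ∀ k < 3, Differentiable ℝ (iteratedDeriv k fun t => g (√|t|))
  /-- its second derivative takes values in `[cmin, cmax]` -/
  second_deriv : ∀ x : ℝ, iteratedDeriv 2 (fun t => g (√|t|)) x ∈ Icc cmin cmax
  /-- its third derivative is bounded by `D` -/
  third_deriv : ∀ x : ℝ, |iteratedDeriv 3 (fun t => g (√|t|)) x| < D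

end

/-!
The function `h(t) = g(√|t|)` is even, so `h'(0) = 0`, and its second derivative lies in
`[cmin, cmax]`. All that is used of it is recorded in `IsPinched`: strong convexity of modulus
`cmin` and the Lipschitz bound `cmax` for `h'`. The contrast is `F̃(u) = 𝔼 h(⟨u, x̃ᵢ⟩²)`.

*Unperturbed picture.* A null vector of the Laplacian is constant on components. With `m` components
and `m` orthogonal columns this forces the rows of `X` to be `U_c / √w_c` for an orthonormal basis
`U` indexed by the components (`SimilarityGraph.exists_isClusterEmbedding`), and the `Z_i` are the
`U_c`. Hence `F(u) = ∑ w_c h(u_c² / w_c)` with `u_c = ⟨u, U_c⟩`, a strongly convex function of the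
point `(u_c²)` of the simplex, whose local maxima are the vertices.

*Perturbation.* Put `ε = ‖H‖ / δ`. The bound on `‖X - X̃‖` gives `𝔼 |⟨u, xᵢ - x̃ᵢ⟩| ≤ 4ε` for unit
vectors `u`, and `ε √n ≤ E` keeps every single row within `4E` of its ideal position. So all
quantities below change by `O(ε)`, with constants depending on `E`, `cmax` and the smallest weight.

*No spurious maxima.* At a local maximum `v` of `F̃`, comparing along great circles with the quadratic
lower bound from strong convexity gives a first-order identity and a second-order inequality
(`IsPinched.optimality_conditions`) without differentiating `h` twice. The first says that the
multipliers `h'(v_c² / w_c)` agree up to `O(ε / |v_c|)`. The second, in the plane of the largest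
coordinate and any other coordinate `k`, gives `v_k² ≲ ε + ε / |v_k|`, that is `|v_k| ≲ ε^{1/3}`
(`IsClusterEmbedding.coord_pow_three_le`). This is the origin of the exponent `1/3`.

*Existence.* Near `± U_c` the function `F` drops at least linearly in `1 - u_c²`, with a slope
proportional to `cmin` on a cap whose size depends only on the weights
(`IsClusterEmbedding.value_le`). The maximum of `F̃` over that cap therefore has `1 - v_c² = O(ε)`
and is interior, provided `ε` is small; otherwise the asserted radius exceeds the diameter of the
sphere and a global maximum of `F̃` serves.
-/

open scoped BigOperators InnerProductSpace

/-! ### Functions with pinched second derivative -/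

/-- `h` is strongly convex with modulus `cmin` and subgradient `h'`, where `h' 0 = 0` and `h'` is
Lipschitz with constant `cmax`. These are the consequences of `cmin ≤ h'' ≤ cmax` that the argument
uses; that `h'` is the derivative of `h` follows and is not recorded. -/
structure IsPinched (cmin cmax : ℝ) (h h' : ℝ → ℝ) : Prop where
  cmin_pos : 0 < cmin
  le_cmax : cmin ≤ cmax
  cont : Continuous h
  zero : h' 0 = 0
  lower : ∀ x y, h x + h' x * (y - x) + cmin / 2 * (y - x) ^ 2 ≤ h y
  lip : ∀ x y, |h' x - h' y| ≤ cmax * |x - y|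

namespace IsPinched

variable {cmin cmax : ℝ} {h h' : ℝ → ℝ}

theorem abs_deriv_le (hh : IsPinched cmin cmax h h') (x : ℝ) : |h' x| ≤ cmax * |x| := by
  simpa [hh.zero] using hh.lip x 0

theorem abs_sub_le (hh : IsPinched cmin cmax h h') {x y M : ℝ} (hx : |x| ≤ M) (hy : |y| ≤ M) :
    |h x - h y| ≤ cmax * M * |x - y| := by
  have hc := hh.cmin_pos.le
  have hc' := hc.trans hh.le_cmax
  have key : ∀ a b : ℝ, |a| ≤ M → h a - h b ≤ cmax * M * |a - b| := by
    intro a b ha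
    have h1 := hh.lower a b
    have h2 := hh.abs_deriv_le a
    have h3 : -(h' a * (b - a)) ≤ |h' a| * |a - b| := by
      rw [abs_sub_comm, ← abs_mul]; exact neg_le_abs _
    have h4 : |h' a| * |a - b| ≤ cmax * M * |a - b| := by
      gcongr; exact h2.trans (by gcongr)
    have h5 : 0 ≤ cmin / 2 * (b - a) ^ 2 := by positivity
    linarith
  rw [abs_le]
  constructor
  · have := key y x hy
    rw [abs_sub_comm] at this; linarith
  · exact key x y hx

theorem le_of_mem_segment (hh : IsPinched cmin cmax h h') {l : ℝ} (h0 : 0 ≤ l) (h1 : l ≤ 1)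
    (x : ℝ) : h (l * x) ≤ l * h x + (1 - l) * h 0 := by
  have a := hh.lower (l * x) x
  have b := hh.lower (l * x) 0
  have hc := hh.cmin_pos.le
  have e1 : 0 ≤ cmin / 2 * (x - l * x) ^ 2 := by positivity
  have e2 : 0 ≤ cmin / 2 * (0 - l * x) ^ 2 := by positivity
  have a' := mul_le_mul_of_nonneg_left a h0
  have b' := mul_le_mul_of_nonneg_left b (sub_nonneg.2 h1)
  have a2 := mul_nonneg h0 e1
  have b2 := mul_nonneg (sub_nonneg.2 h1) e2
  linarith

theorem midpoint_gap (hh : IsPinched cmin cmax h h') (y : ℝ) :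
    cmin * y ^ 2 ≤ h (2 * y) - 2 * h y + h 0 := by
  have a := hh.lower y (2 * y)
  have b := hh.lower y 0
  linarith

end IsPinched

theorem IsRobustContrast.isPinched {cmin cmax D : ℝ} {g : ℝ → ℝ}
    (hg : IsRobustContrast cmin cmax D g) :
    IsPinched cmin cmax (fun t => g (√|t|)) (deriv fun t => g (√|t|)) := by
  set h : ℝ → ℝ := fun t => g (√|t|) with hh
  have d0 : Differentiable ℝ h := by simpa using hg.differentiable 0 (by norm_num)
  have d1 : Differentiable ℝ (deriv h) := by simpa using hg.differentiable 1 (by norm_num)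
  have e2 : ∀ x, deriv (deriv h) x ∈ Icc cmin cmax := by
    intro x
    have := hg.second_deriv x
    rwa [iteratedDeriv_succ, iteratedDeriv_one] at this
  refine ⟨hg.cmin_pos, (e2 0).1.trans (e2 0).2, d0.continuous, ?_, ?_, ?_⟩
  · have heven : (fun t => h (-t)) = h := by funext t; simp [hh]
    have h1 := deriv_comp_neg (f := h) (0 : ℝ)
    rw [heven] at h1
    simp only [neg_zero] at h1
    linarith
  · -- `h - cmin t² / 2` is convex, so it lies above its tangents
    set φ : ℝ → ℝ := fun t => h t - cmin / 2 * t ^ 2 with hφ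
    have q1 : ∀ t, HasDerivAt φ (deriv h t - cmin * t) t := by
      intro t
      have := (d0 t).hasDerivAt.sub (((hasDerivAt_id t).pow 2).const_mul (cmin / 2))
      refine this.congr_deriv ?_
      simp; ring
    have q1' : deriv φ = fun t => deriv h t - cmin * t := funext fun t => (q1 t).deriv
    have q2 : ∀ t, HasDerivAt (deriv φ) (deriv (deriv h) t - cmin) t := by
      intro t
      rw [q1']
      refine ((d1 t).hasDerivAt.sub ((hasDerivAt_id t).const_mul cmin)).congr_deriv ?_
      simp
    have hconv : ConvexOn ℝ univ φ := by
      apply convexOn_of_deriv2_nonneg' convex_univ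
      · exact fun t _ => (q1 t).differentiableAt.differentiableWithinAt
      · exact fun t _ => (q2 t).differentiableAt.differentiableWithinAt
      · intro t _
        simp only [Function.iterate_succ, Function.iterate_zero, Function.comp, id]
        rw [(q2 t).deriv]
        linarith [(e2 t).1]
    intro x y
    have tang : φ x + (deriv h x - cmin * x) * (y - x) ≤ φ y := by
      rcases lt_trichotomy x y with hxy | hxy | hxy
      · have := hconv.le_slope_of_hasDerivAt (mem_univ x) (mem_univ y) hxy (q1 x)
        rw [slope_def_field, le_div_iff₀ (by linarith)] at this
        linarith
      · subst hxy; simp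
      · have := hconv.slope_le_of_hasDerivAt (mem_univ y) (mem_univ x) hxy (q1 x)
        rw [slope_def_field, div_le_iff₀ (by linarith)] at this
        linarith
    simp only [hφ] at tang
    nlinarith [tang]
  · intro x y
    have := Convex.norm_image_sub_le_of_norm_deriv_le (f := deriv h) (s := univ) (x := y) (y := x)
      (C := cmax) (fun t _ => d1 t)
      (fun t _ => by
        rw [Real.norm_eq_abs, abs_of_nonneg (hg.cmin_pos.le.trans (e2 t).1)]; exact (e2 t).2)
      convex_univ (mem_univ _) (mem_univ _)
    simpa [Real.norm_eq_abs] using this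

/-! ### Comparison of the integrands at nearby points -/

section Comparison

variable {cmin cmax : ℝ} {h h' : ℝ → ℝ} {R a a' b b' : ℝ}

theorem abs_sq_sub_sq_le (ha : |a| ≤ R) (ha' : |a'| ≤ R) :
    |a ^ 2 - a' ^ 2| ≤ 2 * R * |a - a'| := by
  rw [sq_sub_sq, abs_mul]
  gcongr
  exact (abs_add_le _ _).trans (by linarith)

theorem abs_mul_sub_mul_le (ha : |a| ≤ R) (hb' : |b'| ≤ R) :
    |a * b - a' * b'| ≤ R * (|a - a'| + |b - b'|) := by
  have : a * b - a' * b' = a * (b - b') + (a - a') * b' := by ring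
  rw [this]
  refine (abs_add_le _ _).trans ?_
  rw [abs_mul, abs_mul]
  nlinarith [abs_nonneg (a - a'), abs_nonneg (b - b')]

namespace IsPinched

theorem abs_comp_sq_sub_le (hh : IsPinched cmin cmax h h') (ha : |a| ≤ R) (ha' : |a'| ≤ R) :
    |h (a ^ 2) - h (a' ^ 2)| ≤ 2 * cmax * R ^ 3 * |a - a'| := by
  have hR : 0 ≤ R := (abs_nonneg a).trans ha
  have hc := hh.cmin_pos.le.trans hh.le_cmax
  have s : ∀ x : ℝ, |x| ≤ R → |x ^ 2| ≤ R ^ 2 := fun x hx => by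
    rw [abs_pow]; gcongr
  calc _ ≤ cmax * R ^ 2 * |a ^ 2 - a' ^ 2| := hh.abs_sub_le (s a ha) (s a' ha')
    _ ≤ cmax * R ^ 2 * (2 * R * |a - a'|) := by gcongr; exact abs_sq_sub_sq_le ha ha'
    _ = _ := by ring

theorem abs_deriv_sq_mul_sub_le (hh : IsPinched cmin cmax h h') (ha : |a| ≤ R) (ha' : |a'| ≤ R)
    {p p' : ℝ} (hp : |p| ≤ R ^ 2) :
    |h' (a ^ 2) * p - h' (a' ^ 2) * p'| ≤ cmax * R ^ 2 * (2 * R * |a - a'| + |p - p'|) := by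
  have hR : 0 ≤ R := (abs_nonneg a).trans ha
  have hc := hh.cmin_pos.le.trans hh.le_cmax
  have e : h' (a ^ 2) * p - h' (a' ^ 2) * p'
      = (h' (a ^ 2) - h' (a' ^ 2)) * p + h' (a' ^ 2) * (p - p') := by ring
  have h1 : |h' (a ^ 2) - h' (a' ^ 2)| ≤ cmax * (2 * R * |a - a'|) :=
    (hh.lip _ _).trans (by gcongr; exact abs_sq_sub_sq_le ha ha')
  have h2 : |h' (a' ^ 2)| ≤ cmax * R ^ 2 :=
    (hh.abs_deriv_le _).trans (by rw [abs_pow]; gcongr)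
  rw [e]
  refine (abs_add_le _ _).trans ?_
  rw [abs_mul, abs_mul]
  calc _ ≤ cmax * (2 * R * |a - a'|) * R ^ 2 + cmax * R ^ 2 * |p - p'| := by gcongr
    _ = _ := by ring

theorem abs_gradient_sub_le (hh : IsPinched cmin cmax h h') (ha : |a| ≤ R) (ha' : |a'| ≤ R)
    (hb : |b| ≤ R) (hb' : |b'| ≤ R) :
    |h' (a ^ 2) * (a * b) - h' (a' ^ 2) * (a' * b')| ≤
      3 * cmax * R ^ 3 * (|a - a'| + |b - b'|) := by
  have hR : 0 ≤ R := (abs_nonneg a).trans ha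
  have hc := hh.cmin_pos.le.trans hh.le_cmax
  have hp : |a * b| ≤ R ^ 2 := by rw [abs_mul, sq]; gcongr
  refine (hh.abs_deriv_sq_mul_sub_le ha ha' hp (p' := a' * b')).trans ?_
  have h1 := abs_mul_sub_mul_le (a' := a') (b := b) ha hb'
  calc _ ≤ cmax * R ^ 2 * (2 * R * |a - a'| + R * (|a - a'| + |b - b'|)) := by gcongr
    _ ≤ cmax * R ^ 2 * (2 * R * (|a - a'| + |b - b'|) + R * (|a - a'| + |b - b'|)) := by
      gcongr; linarith [abs_nonneg (b - b')]
    _ = _ := by ring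

theorem abs_hessian_sub_le (hh : IsPinched cmin cmax h h') (ha : |a| ≤ R) (ha' : |a'| ≤ R)
    (hb : |b| ≤ R) (hb' : |b'| ≤ R) {s : ℝ} (hs : 0 ≤ s) (hs1 : s ≤ 1) :
    |(h' (a ^ 2) * (b ^ 2 - s * a ^ 2) + 2 * cmin * (a ^ 2 * b ^ 2)) -
        (h' (a' ^ 2) * (b' ^ 2 - s * a' ^ 2) + 2 * cmin * (a' ^ 2 * b' ^ 2))| ≤
      8 * cmax * R ^ 3 * (|a - a'| + |b - b'|) := by
  have hR : 0 ≤ R := (abs_nonneg a).trans ha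
  have hc := hh.cmin_pos.le.trans hh.le_cmax
  have hcm := hh.cmin_pos.le
  have sa : a ^ 2 ≤ R ^ 2 := sq_le_sq' (abs_le.1 ha).1 (abs_le.1 ha).2
  have sb : b ^ 2 ≤ R ^ 2 := sq_le_sq' (abs_le.1 hb).1 (abs_le.1 hb).2
  have hp : |b ^ 2 - s * a ^ 2| ≤ R ^ 2 := by
    have : s * a ^ 2 ≤ 1 * R ^ 2 := by gcongr
    have : 0 ≤ s * a ^ 2 := by positivity
    rw [abs_le]; constructor <;> nlinarith [sq_nonneg b]
  have k1 := hh.abs_deriv_sq_mul_sub_le ha ha' hp (p' := b' ^ 2 - s * a' ^ 2)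
  have k2 : |(b ^ 2 - s * a ^ 2) - (b' ^ 2 - s * a' ^ 2)| ≤ 2 * R * (|a - a'| + |b - b'|) := by
    have e : (b ^ 2 - s * a ^ 2) - (b' ^ 2 - s * a' ^ 2)
      = (b ^ 2 - b' ^ 2) - s * (a ^ 2 - a' ^ 2) := by ring
    rw [e]
    refine (abs_sub _ _).trans ?_
    rw [abs_mul, abs_of_nonneg hs]
    have h1 := abs_sq_sub_sq_le hb hb'
    have h2 := abs_sq_sub_sq_le ha ha'
    have h3 : s * |a ^ 2 - a' ^ 2| ≤ 1 * |a ^ 2 - a' ^ 2| := by gcongr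
    linarith
  have k3 : |a ^ 2 * b ^ 2 - a' ^ 2 * b' ^ 2| ≤ 2 * R ^ 3 * (|a - a'| + |b - b'|) := by
    have e : a ^ 2 * b ^ 2 - a' ^ 2 * b' ^ 2 = (a * b) ^ 2 - (a' * b') ^ 2 := by ring
    have p1 : |a * b| ≤ R ^ 2 := by rw [abs_mul, sq]; gcongr
    have p2 : |a' * b'| ≤ R ^ 2 := by rw [abs_mul, sq]; gcongr
    rw [e]
    refine (abs_sq_sub_sq_le p1 p2).trans ?_
    have h1 := abs_mul_sub_mul_le (a' := a') (b := b) ha hb'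
    calc _ ≤ 2 * R ^ 2 * (R * (|a - a'| + |b - b'|)) := by gcongr
      _ = _ := by ring
  have e : (h' (a ^ 2) * (b ^ 2 - s * a ^ 2) + 2 * cmin * (a ^ 2 * b ^ 2)) -
        (h' (a' ^ 2) * (b' ^ 2 - s * a' ^ 2) + 2 * cmin * (a' ^ 2 * b' ^ 2)) =
      (h' (a ^ 2) * (b ^ 2 - s * a ^ 2) - h' (a' ^ 2) * (b' ^ 2 - s * a' ^ 2)) +
        2 * cmin * (a ^ 2 * b ^ 2 - a' ^ 2 * b' ^ 2) := by ring
  rw [e]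
  refine (abs_add_le _ _).trans ?_
  rw [abs_mul (2 * cmin), abs_of_nonneg (by positivity : 0 ≤ 2 * cmin)]
  calc _ ≤ cmax * R ^ 2 * (2 * R * (|a - a'| + |b - b'|) + 2 * R * (|a - a'| + |b - b'|)) +
        2 * cmax * (2 * R ^ 3 * (|a - a'| + |b - b'|)) := by
        refine add_le_add (k1.trans ?_) ?_
        · gcongr; linarith [abs_nonneg (b - b')]
        · gcongr; exact hh.le_cmax
    _ = _ := by ring

end IsPinched

end Comparison

/-! ### Optimality conditions on the sphere -/

/-- First- and second-order necessary conditions read off from a quartic minorant. -/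
theorem coeff_of_eventually_quartic_nonpos {α β γ δ : ℝ}
    (hp : ∀ᶠ t in 𝓝 (0 : ℝ), α * t + β * t ^ 2 + γ * t ^ 3 + δ * t ^ 4 ≤ 0) :
    α = 0 ∧ β ≤ 0 := by
  have hn : ∀ᶠ t in 𝓝 (0 : ℝ), α * -t + β * (-t) ^ 2 + γ * (-t) ^ 3 + δ * (-t) ^ 4 ≤ 0 := by
    have : Tendsto (fun t : ℝ => -t) (𝓝 0) (𝓝 0) := by simpa using (continuous_neg.tendsto (0 : ℝ))
    exact this.eventually hp
  have lim : ∀ f : ℝ → ℝ, Continuous f → (∀ᶠ t in 𝓝[>] (0 : ℝ), f t ≤ 0) → f 0 ≤ 0 :=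
    fun f hf h => le_of_tendsto (hf.continuousWithinAt.tendsto) h
  have h1 := lim (fun t => α + β * t + γ * t ^ 2 + δ * t ^ 3) (by fun_prop) (by
    filter_upwards [hp.filter_mono nhdsWithin_le_nhds, self_mem_nhdsWithin] with t ht (ht0 : 0 < t)
    refine nonpos_of_mul_nonpos_right (a := t) ?_ ht0
    linarith)
  have h2 := lim (fun t => -α + β * t - γ * t ^ 2 + δ * t ^ 3) (by fun_prop) (by
    filter_upwards [hn.filter_mono nhdsWithin_le_nhds, self_mem_nhdsWithin] with t ht (ht0 : 0 < t)
    refine nonpos_of_mul_nonpos_right (a := t) ?_ ht0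
    linarith)
  have h3 := lim (fun t => β + δ * t ^ 2) (by fun_prop) (by
    filter_upwards [hp.filter_mono nhdsWithin_le_nhds, hn.filter_mono nhdsWithin_le_nhds,
      self_mem_nhdsWithin] with t ht ht' (ht0 : 0 < t)
    refine nonpos_of_mul_nonpos_right (a := t ^ 2) ?_ (by positivity)
    linarith)
  simp only [mul_zero, add_zero, ne_eq, OfNat.ofNat_ne_zero, not_false_eq_true, zero_pow,
    sub_zero] at h1 h2 h3
  exact ⟨by linarith, h3⟩

section Sphere

variable {n m : ℕ} {cmin cmax : ℝ} {h h' : ℝ → ℝ}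

/-- Optimality of `u ↦ 𝔼 h(⟨u, yᵢ⟩²)` at `v` on the sphere in a tangent direction `ξ`. Only strong
convexity of `h` enters, which replaces `h''` by its lower bound `cmin` and makes any regularity of
`h''` superfluous. -/
theorem IsPinched.optimality_conditions (hh : IsPinched cmin cmax h h')
    {y : Fin n → EuclideanSpace ℝ (Fin m)} {v ξ : EuclideanSpace ℝ (Fin m)}
    (hv : IsSphereLocalMax (fun u => 𝔼 i, h (⟪u, y i⟫_ℝ ^ 2)) v) (hξ : ⟪v, ξ⟫_ℝ = 0) :
    𝔼 i, h' (⟪v, y i⟫_ℝ ^ 2) * (⟪v, y i⟫_ℝ * ⟪ξ, y i⟫_ℝ) = 0 ∧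
    𝔼 i, (h' (⟪v, y i⟫_ℝ ^ 2) * (⟪ξ, y i⟫_ℝ ^ 2 - ‖ξ‖ ^ 2 * ⟪v, y i⟫_ℝ ^ 2) +
      2 * cmin * (⟪v, y i⟫_ℝ ^ 2 * ⟪ξ, y i⟫_ℝ ^ 2)) ≤ 0 := by
  obtain ⟨hv1, hmax⟩ := hv
  have hvn : ‖v‖ = 1 := by simpa using hv1
  set s := ‖ξ‖ ^ 2 with hs
  have hs0 : 0 ≤ s := by positivity
  have hD : ∀ t : ℝ, 0 < 1 + s * t ^ 2 := fun t => by positivity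
  -- the great circle through `v` in the direction `ξ`, parametrized by the tangent
  set γ : ℝ → EuclideanSpace ℝ (Fin m) := fun t => (√(1 + s * t ^ 2))⁻¹ • (v + t • ξ) with hγ
  have hnorm : ∀ t, ‖v + t • ξ‖ ^ 2 = 1 + s * t ^ 2 := by
    intro t
    rw [norm_add_sq_real, inner_smul_right, hξ, norm_smul, hvn, mul_pow, Real.norm_eq_abs, sq_abs]
    ring
  have hsphere : ∀ t, γ t ∈ Metric.sphere (0 : EuclideanSpace ℝ (Fin m)) 1 := by
    intro t
    have hn : ‖v + t • ξ‖ = √(1 + s * t ^ 2) := by rw [← hnorm t, Real.sqrt_sq (norm_nonneg _)]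
    have h0 : √(1 + s * t ^ 2) ≠ 0 := (Real.sqrt_pos.2 (hD t)).ne'
    simp only [mem_sphere_iff_norm, sub_zero, hγ, norm_smul, norm_inv, Real.norm_eq_abs, hn,
      abs_of_nonneg (Real.sqrt_nonneg _)]
    exact inv_mul_cancel₀ h0
  have hcont : Continuous γ := by
    have h1 : Continuous fun t : ℝ => √(1 + s * t ^ 2) := by fun_prop
    have h2 : Continuous fun t : ℝ => v + t • ξ := by fun_prop
    refine (h1.inv₀ fun t => ?_).smul h2
    exact (Real.sqrt_pos.2 (hD t)).ne'
  have hγ0 : γ 0 = v := by simp [hγ]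
  have hev : ∀ᶠ t in 𝓝 (0 : ℝ),
      𝔼 i, h (⟪γ t, y i⟫_ℝ ^ 2) ≤ 𝔼 i, h (⟪v, y i⟫_ℝ ^ 2) := by
    have ht : Tendsto γ (𝓝 0) (𝓝[Metric.sphere (0 : EuclideanSpace ℝ (Fin m)) 1] v) := by
      refine tendsto_nhdsWithin_iff.2 ⟨?_, Eventually.of_forall hsphere⟩
      simpa [hγ0] using hcont.tendsto 0
    exact ht.eventually hmax
  have hval : ∀ t i, (1 + s * t ^ 2) * ⟪γ t, y i⟫_ℝ ^ 2 = (⟪v, y i⟫_ℝ + t * ⟪ξ, y i⟫_ℝ) ^ 2 := by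
    intro t i
    have h0 : √(1 + s * t ^ 2) ≠ 0 := (Real.sqrt_pos.2 (hD t)).ne'
    simp only [hγ, real_inner_smul_left, inner_add_left, mul_pow, inv_pow,
      Real.sq_sqrt (hD t).le]
    field_simp [(hD t).ne']
  have key : ∀ᶠ t in 𝓝 (0 : ℝ),
      (𝔼 i, 2 * (h' (⟪v, y i⟫_ℝ ^ 2) * (⟪v, y i⟫_ℝ * ⟪ξ, y i⟫_ℝ))) * t +
      (𝔼 i, (h' (⟪v, y i⟫_ℝ ^ 2) * (⟪ξ, y i⟫_ℝ ^ 2 - s * ⟪v, y i⟫_ℝ ^ 2) +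
        2 * cmin * (⟪v, y i⟫_ℝ ^ 2 * ⟪ξ, y i⟫_ℝ ^ 2))) * t ^ 2 +
      (𝔼 i, (2 * s * (h' (⟪v, y i⟫_ℝ ^ 2) * (⟪v, y i⟫_ℝ * ⟪ξ, y i⟫_ℝ)) +
        2 * cmin * (⟪v, y i⟫_ℝ * ⟪ξ, y i⟫_ℝ * (⟪ξ, y i⟫_ℝ ^ 2 - s * ⟪v, y i⟫_ℝ ^ 2)))) * t ^ 3 +
      (𝔼 i, (s * (h' (⟪v, y i⟫_ℝ ^ 2) * (⟪ξ, y i⟫_ℝ ^ 2 - s * ⟪v, y i⟫_ℝ ^ 2)) +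
        cmin / 2 * (⟪ξ, y i⟫_ℝ ^ 2 - s * ⟪v, y i⟫_ℝ ^ 2) ^ 2)) * t ^ 4 ≤ 0 := by
    filter_upwards [hev] with t ht
    have hle : (1 + s * t ^ 2) ^ 2 *
        (𝔼 i, h (⟪γ t, y i⟫_ℝ ^ 2) - 𝔼 i, h (⟪v, y i⟫_ℝ ^ 2)) ≤ 0 :=
      mul_nonpos_of_nonneg_of_nonpos (by positivity) (by linarith)
    refine le_trans ?_ hle
    rw [← Finset.expect_sub_distrib, Finset.mul_expect, Finset.expect_mul, Finset.expect_mul,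
      Finset.expect_mul, Finset.expect_mul, ← Finset.expect_add_distrib,
      ← Finset.expect_add_distrib, ← Finset.expect_add_distrib]
    refine Finset.expect_le_expect fun i _ => ?_
    have hl := hh.lower (⟪v, y i⟫_ℝ ^ 2) (⟪γ t, y i⟫_ℝ ^ 2)
    have e := hval t i
    generalize ⟪γ t, y i⟫_ℝ ^ 2 = Y at *
    generalize ⟪v, y i⟫_ℝ = a at *
    generalize ⟪ξ, y i⟫_ℝ = b at *
    have e' : (1 + s * t ^ 2) * (Y - a ^ 2) = 2 * t * (a * b) + t ^ 2 * (b ^ 2 - s * a ^ 2) := by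
      linear_combination e
    have hl' := mul_le_mul_of_nonneg_left hl (sq_nonneg (1 + s * t ^ 2))
    refine le_of_eq_of_le (b := (1 + s * t ^ 2) ^ 2 *
      (h' (a ^ 2) * (Y - a ^ 2) + cmin / 2 * (Y - a ^ 2) ^ 2)) ?_ (by linarith)
    have e2 : (1 + s * t ^ 2) ^ 2 * (h' (a ^ 2) * (Y - a ^ 2) + cmin / 2 * (Y - a ^ 2) ^ 2) =
      (1 + s * t ^ 2) * h' (a ^ 2) * ((1 + s * t ^ 2) * (Y - a ^ 2)) +
        cmin / 2 * ((1 + s * t ^ 2) * (Y - a ^ 2)) ^ 2 := by ring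
    rw [e2, e']
    ring
  obtain ⟨k1, k2⟩ := coeff_of_eventually_quartic_nonpos key
  refine ⟨?_, k2⟩
  rw [← Finset.mul_expect] at k1
  linarith

end Sphere

/-! ### Ideal and perturbed embeddings -/

section Embedding

variable {n m : ℕ} {ι : Type*} [Fintype ι] {cmin cmax : ℝ} {h h' : ℝ → ℝ}

/-- The points `x i` sit at the vectors `U j / √(w j)`, where `U` is an orthonormal basis; `c i` is
the cluster of `x i`, and a proportion `w j` of the points belongs to the cluster `j`. -/
structure IsClusterEmbedding (w : ι → ℝ) (U : OrthonormalBasis ι ℝ (EuclideanSpace ℝ (Fin m)))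
    (c : Fin n → ι) (x : Fin n → EuclideanSpace ℝ (Fin m)) : Prop where
  pos : ∀ j, 0 < w j
  apply_eq : ∀ i, x i = (√(w (c i)))⁻¹ • U (c i)
  expect_comp : ∀ f : ι → ℝ, 𝔼 i, f (c i) = ∑ j, w j * f j

/-- `x` and `y` are bounded by `R` in every direction and `ε`-close in `L¹` in every direction. -/
structure IsCloseEmbedding (R ε : ℝ) (x y : Fin n → EuclideanSpace ℝ (Fin m)) : Prop where
  bound_left : ∀ u i, |⟪u, x i⟫_ℝ| ≤ R * ‖u‖
  bound_right : ∀ u i, |⟪u, y i⟫_ℝ| ≤ R * ‖u‖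
  mean : ∀ u, 𝔼 i, |⟪u, x i⟫_ℝ - ⟪u, y i⟫_ℝ| ≤ ε * ‖u‖

theorem IsCloseEmbedding.abs_expect_sub_le {R ε : ℝ} {x y : Fin n → EuclideanSpace ℝ (Fin m)}
    (hxy : IsCloseEmbedding R ε x y) {u ξ : EuclideanSpace ℝ (Fin m)} (hu : ‖u‖ ≤ 1)
    (hξ : ‖ξ‖ ≤ 1) (hε : 0 ≤ ε) {K : ℝ} (hK : 0 ≤ K) {f f' : Fin n → ℝ}
    (hf : ∀ i, |f i - f' i| ≤
      K * (|⟪u, x i⟫_ℝ - ⟪u, y i⟫_ℝ| + |⟪ξ, x i⟫_ℝ - ⟪ξ, y i⟫_ℝ|)) :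
    |𝔼 i, f i - 𝔼 i, f' i| ≤ 2 * K * ε := by
  rw [← Finset.expect_sub_distrib]
  calc _ ≤ 𝔼 i, |f i - f' i| := Finset.abs_expect_le _ _
    _ ≤ 𝔼 i, K * (|⟪u, x i⟫_ℝ - ⟪u, y i⟫_ℝ| + |⟪ξ, x i⟫_ℝ - ⟪ξ, y i⟫_ℝ|) :=
      Finset.expect_le_expect fun i _ => hf i
    _ = K * (𝔼 i, |⟪u, x i⟫_ℝ - ⟪u, y i⟫_ℝ| + 𝔼 i, |⟪ξ, x i⟫_ℝ - ⟪ξ, y i⟫_ℝ|) := by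
      rw [← Finset.mul_expect, Finset.expect_add_distrib]
    _ ≤ K * (ε * 1 + ε * 1) := by
      gcongr
      · exact (hxy.mean u).trans (by gcongr)
      · exact (hxy.mean ξ).trans (by gcongr)
    _ = _ := by ring

namespace IsClusterEmbedding

variable {w : ι → ℝ} {U : OrthonormalBasis ι ℝ (EuclideanSpace ℝ (Fin m))} {c : Fin n → ι}
  {x y : Fin n → EuclideanSpace ℝ (Fin m)}

theorem inner_mul_inner (hx : IsClusterEmbedding w U c x) (u ξ : EuclideanSpace ℝ (Fin m))
    (i : Fin n) : ⟪u, x i⟫_ℝ * ⟪ξ, x i⟫_ℝ = ⟪u, U (c i)⟫_ℝ * ⟪ξ, U (c i)⟫_ℝ / w (c i) := by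
  have h1 := Real.mul_self_sqrt (hx.pos (c i)).le
  have h0 : √(w (c i)) ≠ 0 := (Real.sqrt_pos.2 (hx.pos (c i))).ne'
  rw [hx.apply_eq, inner_smul_right, inner_smul_right]
  nth_rewrite 3 [← h1]
  field_simp

theorem inner_sq (hx : IsClusterEmbedding w U c x) (u : EuclideanSpace ℝ (Fin m))
    (i : Fin n) : ⟪u, x i⟫_ℝ ^ 2 = ⟪u, U (c i)⟫_ℝ ^ 2 / w (c i) := by
  rw [sq, hx.inner_mul_inner, sq]

theorem expect_value (hx : IsClusterEmbedding w U c x) (h : ℝ → ℝ)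
    (u : EuclideanSpace ℝ (Fin m)) :
    𝔼 i, h (⟪u, x i⟫_ℝ ^ 2) = ∑ j, w j * h (⟪u, U j⟫_ℝ ^ 2 / w j) := by
  rw [← hx.expect_comp fun j => h (⟪u, U j⟫_ℝ ^ 2 / w j)]
  simp only [hx.inner_sq]

theorem expect_gradient (hx : IsClusterEmbedding w U c x) (h' : ℝ → ℝ)
    (u ξ : EuclideanSpace ℝ (Fin m)) :
    𝔼 i, h' (⟪u, x i⟫_ℝ ^ 2) * (⟪u, x i⟫_ℝ * ⟪ξ, x i⟫_ℝ) =
      ∑ j, h' (⟪u, U j⟫_ℝ ^ 2 / w j) * (⟪u, U j⟫_ℝ * ⟪ξ, U j⟫_ℝ) := by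
  have e := hx.expect_comp fun j =>
    h' (⟪u, U j⟫_ℝ ^ 2 / w j) * (⟪u, U j⟫_ℝ * ⟪ξ, U j⟫_ℝ / w j)
  simp only [hx.inner_sq, hx.inner_mul_inner]
  rw [e]
  refine Finset.sum_congr rfl fun j _ => ?_
  have := (hx.pos j).ne'
  field_simp

theorem expect_hessian (hx : IsClusterEmbedding w U c x) (h' : ℝ → ℝ) (cmin s : ℝ)
    (u ξ : EuclideanSpace ℝ (Fin m)) :
    𝔼 i, (h' (⟪u, x i⟫_ℝ ^ 2) * (⟪ξ, x i⟫_ℝ ^ 2 - s * ⟪u, x i⟫_ℝ ^ 2) +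
      2 * cmin * (⟪u, x i⟫_ℝ ^ 2 * ⟪ξ, x i⟫_ℝ ^ 2)) =
    ∑ j, (h' (⟪u, U j⟫_ℝ ^ 2 / w j) * (⟪ξ, U j⟫_ℝ ^ 2 - s * ⟪u, U j⟫_ℝ ^ 2) +
      2 * cmin * (⟪u, U j⟫_ℝ ^ 2 * ⟪ξ, U j⟫_ℝ ^ 2 / w j)) := by
  have e := hx.expect_comp fun j =>
    h' (⟪u, U j⟫_ℝ ^ 2 / w j) * (⟪ξ, U j⟫_ℝ ^ 2 / w j - s * (⟪u, U j⟫_ℝ ^ 2 / w j)) +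
      2 * cmin * (⟪u, U j⟫_ℝ ^ 2 / w j * (⟪ξ, U j⟫_ℝ ^ 2 / w j))
  simp only [hx.inner_sq]
  rw [e]
  refine Finset.sum_congr rfl fun j _ => ?_
  have := (hx.pos j).ne'
  field_simp

variable {R ε : ℝ}

theorem abs_value_sub_le (hx : IsClusterEmbedding w U c x) (hh : IsPinched cmin cmax h h')
    (hxy : IsCloseEmbedding R ε x y) (hε : 0 ≤ ε) (hR : 0 ≤ R) {u : EuclideanSpace ℝ (Fin m)}
    (hu : ‖u‖ = 1) :
    |∑ j, w j * h (⟪u, U j⟫_ℝ ^ 2 / w j) - 𝔼 i, h (⟪u, y i⟫_ℝ ^ 2)| ≤ 2 * cmax * R ^ 3 * ε := by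
  have hc := hh.cmin_pos.le.trans hh.le_cmax
  rw [← hx.expect_value h u]
  refine (hxy.abs_expect_sub_le hu.le hu.le hε (K := cmax * R ^ 3) (by positivity)
    fun i => ?_).trans_eq (by ring)
  have b1 := hxy.bound_left u i
  have b2 := hxy.bound_right u i
  rw [hu, mul_one] at b1 b2
  refine (hh.abs_comp_sq_sub_le b1 b2).trans_eq (by ring)

theorem gradient_le (hx : IsClusterEmbedding w U c x) (hh : IsPinched cmin cmax h h')
    (hxy : IsCloseEmbedding R ε x y) (hε : 0 ≤ ε) (hR : 0 ≤ R) {v ξ : EuclideanSpace ℝ (Fin m)}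
    (hv : IsSphereLocalMax (fun u => 𝔼 i, h (⟪u, y i⟫_ℝ ^ 2)) v) (hvξ : ⟪v, ξ⟫_ℝ = 0)
    (hξ : ‖ξ‖ ≤ 1) :
    |∑ j, h' (⟪v, U j⟫_ℝ ^ 2 / w j) * (⟪v, U j⟫_ℝ * ⟪ξ, U j⟫_ℝ)| ≤ 6 * cmax * R ^ 3 * ε := by
  have hc := hh.cmin_pos.le.trans hh.le_cmax
  have hvn : ‖v‖ = 1 := by simpa using hv.1
  have h0 := (hh.optimality_conditions hv hvξ).1
  rw [← hx.expect_gradient, ← sub_zero (𝔼 i, _), ← h0]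
  refine (hxy.abs_expect_sub_le hvn.le hξ hε (K := 3 * cmax * R ^ 3) (by positivity)
    fun i => ?_).trans_eq (by ring)
  have b1 := (hxy.bound_left v i).trans (mul_le_of_le_one_right hR hvn.le)
  have b2 := (hxy.bound_right v i).trans (mul_le_of_le_one_right hR hvn.le)
  have b3 := (hxy.bound_left ξ i).trans (mul_le_of_le_one_right hR hξ)
  have b4 := (hxy.bound_right ξ i).trans (mul_le_of_le_one_right hR hξ)
  exact hh.abs_gradient_sub_le b1 b2 b3 b4

theorem hessian_le (hx : IsClusterEmbedding w U c x) (hh : IsPinched cmin cmax h h')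
    (hxy : IsCloseEmbedding R ε x y) (hε : 0 ≤ ε) (hR : 0 ≤ R) {v ξ : EuclideanSpace ℝ (Fin m)}
    (hv : IsSphereLocalMax (fun u => 𝔼 i, h (⟪u, y i⟫_ℝ ^ 2)) v) (hvξ : ⟪v, ξ⟫_ℝ = 0)
    (hξ : ‖ξ‖ = 1) :
    ∑ j, (h' (⟪v, U j⟫_ℝ ^ 2 / w j) * (⟪ξ, U j⟫_ℝ ^ 2 - ⟪v, U j⟫_ℝ ^ 2) +
      2 * cmin * (⟪v, U j⟫_ℝ ^ 2 * ⟪ξ, U j⟫_ℝ ^ 2 / w j)) ≤ 16 * cmax * R ^ 3 * ε := by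
  have hc := hh.cmin_pos.le.trans hh.le_cmax
  have hvn : ‖v‖ = 1 := by simpa using hv.1
  have h0 := (hh.optimality_conditions hv hvξ).2
  have e := hx.expect_hessian h' cmin 1 v ξ
  simp only [one_mul] at e
  rw [← e]
  simp only [hξ, one_pow, one_mul] at h0
  have := hxy.abs_expect_sub_le hvn.le hξ.le hε (K := 8 * cmax * R ^ 3) (by positivity)
    (f := fun i => h' (⟪v, x i⟫_ℝ ^ 2) * (⟪ξ, x i⟫_ℝ ^ 2 - ⟪v, x i⟫_ℝ ^ 2) +
      2 * cmin * (⟪v, x i⟫_ℝ ^ 2 * ⟪ξ, x i⟫_ℝ ^ 2))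
    (f' := fun i => h' (⟪v, y i⟫_ℝ ^ 2) * (⟪ξ, y i⟫_ℝ ^ 2 - ⟪v, y i⟫_ℝ ^ 2) +
      2 * cmin * (⟪v, y i⟫_ℝ ^ 2 * ⟪ξ, y i⟫_ℝ ^ 2))
    fun i => by
      have b1 := (hxy.bound_left v i).trans (mul_le_of_le_one_right hR hvn.le)
      have b2 := (hxy.bound_right v i).trans (mul_le_of_le_one_right hR hvn.le)
      have b3 := (hxy.bound_left ξ i).trans (mul_le_of_le_one_right hR hξ.le)
      have b4 := (hxy.bound_right ξ i).trans (mul_le_of_le_one_right hR hξ.le)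
      simpa only [one_mul] using hh.abs_hessian_sub_le b1 b2 b3 b4 zero_le_one le_rfl
  linarith [(abs_le.1 this).2]

end IsClusterEmbedding

end Embedding

/-! ### Location of the local maxima -/

section Location

variable {n m : ℕ} {ι : Type*} [Fintype ι] {cmin cmax : ℝ} {h h' : ℝ → ℝ}
  {w : ι → ℝ} {U : OrthonormalBasis ι ℝ (EuclideanSpace ℝ (Fin m))} {c : Fin n → ι}
  {x y : Fin n → EuclideanSpace ℝ (Fin m)} {R ε : ℝ}

theorem OrthonormalBasis.sum_sq_inner_eq_one
    (U : OrthonormalBasis ι ℝ (EuclideanSpace ℝ (Fin m))) {v : EuclideanSpace ℝ (Fin m)}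
    (hv : ‖v‖ = 1) : ∑ j, ⟪v, U j⟫_ℝ ^ 2 = 1 := by
  have := U.sum_sq_norm_inner_right v
  simpa [hv, Real.norm_eq_abs, sq_abs, real_inner_comm] using this

theorem OrthonormalBasis.norm_smul_sub_sq_le
    (U : OrthonormalBasis ι ℝ (EuclideanSpace ℝ (Fin m))) {v : EuclideanSpace ℝ (Fin m)}
    (hv : ‖v‖ = 1) {i : ι} {s : ℝ} (hs : s ∈ ({1, -1} : Set ℝ)) (hsv : 0 ≤ s * ⟪v, U i⟫_ℝ) :
    ‖s • U i - v‖ ^ 2 ≤ 2 * (1 - ⟪v, U i⟫_ℝ ^ 2) := by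
  have hs2 : s ^ 2 = 1 := by
    rcases hs with rfl | hs
    · norm_num
    · rw [Set.mem_singleton_iff.1 hs]; norm_num
  have hle : s * ⟪v, U i⟫_ℝ ≤ 1 := by
    have h1 := abs_real_inner_le_norm v (U i)
    rw [hv, U.norm_eq_one, mul_one, ← sq_le_one_iff_abs_le_one] at h1
    nlinarith [sq_nonneg (s * ⟪v, U i⟫_ℝ - 1)]
  rw [norm_sub_sq_real, norm_smul, mul_pow, Real.norm_eq_abs, sq_abs, hs2, hv, U.norm_eq_one,
    real_inner_smul_left, real_inner_comm]
  have : ⟪v, U i⟫_ℝ ^ 2 = (s * ⟪v, U i⟫_ℝ) ^ 2 := by rw [mul_pow, hs2, one_mul]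
  rw [this]
  nlinarith

namespace IsClusterEmbedding

/-- At a local maximum the multipliers `h'(uⱼ²/wⱼ)` almost agree on the large coordinates. -/
theorem abs_coord_mul_multiplier_sub_le (hx : IsClusterEmbedding w U c x)
    (hh : IsPinched cmin cmax h h') (hxy : IsCloseEmbedding R ε x y) (hε : 0 ≤ ε) (hR : 0 ≤ R)
    {v : EuclideanSpace ℝ (Fin m)}
    (hv : IsSphereLocalMax (fun u => 𝔼 i, h (⟪u, y i⟫_ℝ ^ 2)) v) (k : ι) :
    |⟪v, U k⟫_ℝ| * |h' (⟪v, U k⟫_ℝ ^ 2 / w k) -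
      ∑ j, h' (⟪v, U j⟫_ℝ ^ 2 / w j) * ⟪v, U j⟫_ℝ ^ 2| ≤ 6 * cmax * R ^ 3 * ε := by
  classical
  have hvn : ‖v‖ = 1 := by simpa using hv.1
  set ξ := U k - ⟪v, U k⟫_ℝ • v with hξ
  have h1 : ⟪v, ξ⟫_ℝ = 0 := by
    rw [hξ, inner_sub_right, inner_smul_right, real_inner_self_eq_norm_sq, hvn]; ring
  have h2 : ‖ξ‖ ≤ 1 := by
    have : ‖ξ‖ ^ 2 = 1 - ⟪v, U k⟫_ℝ ^ 2 := by
      rw [hξ, norm_sub_sq_real, inner_smul_right, norm_smul, U.norm_eq_one, hvn, mul_one,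
        Real.norm_eq_abs, sq_abs, real_inner_comm]
      ring
    have h3 : ‖ξ‖ ^ 2 ≤ 1 ^ 2 := by rw [this]; linarith [sq_nonneg ⟪v, U k⟫_ℝ]
    exact le_of_sq_le_sq h3 zero_le_one
  have key := hx.gradient_le hh hxy hε hR hv h1 h2
  have e : ∀ j, ⟪ξ, U j⟫_ℝ = (if k = j then 1 else 0) - ⟪v, U k⟫_ℝ * ⟪v, U j⟫_ℝ := by
    intro j
    rw [hξ, inner_sub_left, real_inner_smul_left, orthonormal_iff_ite.1 U.orthonormal]
  have e2 : ∑ j, h' (⟪v, U j⟫_ℝ ^ 2 / w j) * (⟪v, U j⟫_ℝ * ⟪ξ, U j⟫_ℝ) =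
      ⟪v, U k⟫_ℝ * (h' (⟪v, U k⟫_ℝ ^ 2 / w k) -
        ∑ j, h' (⟪v, U j⟫_ℝ ^ 2 / w j) * ⟪v, U j⟫_ℝ ^ 2) := by
    simp only [e, mul_sub, Finset.sum_sub_distrib, mul_ite, mul_one, mul_zero,
      Finset.sum_ite_eq, Finset.mem_univ, if_true, Finset.mul_sum]
    congr 1
    · ring
    · exact Finset.sum_congr rfl fun j _ => by ring
  rwa [e2, abs_mul] at key

/-- At a local maximum every coordinate but the largest is small: moving mass between two
coordinates gains to second order by strong convexity, against errors of size `ε`. -/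
theorem coord_pow_three_le (hx : IsClusterEmbedding w U c x) (hh : IsPinched cmin cmax h h')
    (hxy : IsCloseEmbedding R ε x y) (hε : 0 ≤ ε) (hR : 0 ≤ R) {W : ℝ} (hW : ∀ j, w j ≤ W)
    {v : EuclideanSpace ℝ (Fin m)}
    (hv : IsSphereLocalMax (fun u => 𝔼 i, h (⟪u, y i⟫_ℝ ^ 2)) v) {i k : ι} (hik : i ≠ k)
    (hle : |⟪v, U k⟫_ℝ| ≤ |⟪v, U i⟫_ℝ|) :
    cmin * |⟪v, U k⟫_ℝ| ^ 3 ≤ 11 * cmax * R ^ 3 * ε * W := by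
  classical
  have hc := hh.cmin_pos
  have hc' := hc.le.trans hh.le_cmax
  have hvn : ‖v‖ = 1 := by simpa using hv.1
  have hW0 : 0 < W := (hx.pos i).trans_le (hW i)
  rcases eq_or_ne ⟪v, U k⟫_ℝ 0 with hk0 | hk0
  · rw [hk0]
    have : 0 ≤ 11 * cmax * R ^ 3 * ε * W := by positivity
    simpa using this
  have gi := hx.abs_coord_mul_multiplier_sub_le hh hxy hε hR hv i
  have gk := hx.abs_coord_mul_multiplier_sub_le hh hxy hε hR hv k
  set μ := ∑ j, h' (⟪v, U j⟫_ℝ ^ 2 / w j) * ⟪v, U j⟫_ℝ ^ 2 with hμ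
  set a := ⟪v, U i⟫_ℝ with ha
  set b := ⟪v, U k⟫_ℝ with hb
  have hb0 : 0 < |b| := abs_pos.2 hk0
  set S := a ^ 2 + b ^ 2 with hS
  have hS0 : 0 < S := by positivity
  -- the unit vector in the plane of `U i`, `U k` that is tangent at `v`
  set ξ := (√S)⁻¹ • (b • U i - a • U k) with hξ
  have hsq : (√S)⁻¹ ^ 2 = S⁻¹ := by rw [inv_pow, Real.sq_sqrt hS0.le]
  have horth : ⟪U i, U k⟫_ℝ = 0 := U.orthonormal.2 hik
  have h1 : ⟪v, ξ⟫_ℝ = 0 := by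
    rw [hξ, inner_smul_right, inner_sub_right, inner_smul_right, inner_smul_right, ← ha, ← hb]
    ring
  have h2 : ‖ξ‖ = 1 := by
    have : ‖ξ‖ ^ 2 = 1 := by
      rw [hξ, norm_smul, mul_pow, Real.norm_eq_abs, sq_abs, hsq, norm_sub_sq_real, norm_smul,
        norm_smul, real_inner_smul_left, inner_smul_right, horth, U.norm_eq_one, U.norm_eq_one,
        Real.norm_eq_abs, Real.norm_eq_abs, mul_one, mul_one, sq_abs, sq_abs]
      field_simp
      rw [hS]; ring
    exact (pow_eq_one_iff_of_nonneg (norm_nonneg _) two_ne_zero).1 this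
  have key := hx.hessian_le hh hxy hε hR hv h1 h2
  have hξsum : ∑ j, ⟪ξ, U j⟫_ℝ ^ 2 = 1 := U.sum_sq_inner_eq_one h2
  have ei : ⟪ξ, U i⟫_ℝ ^ 2 = b ^ 2 / S := by
    rw [hξ, real_inner_smul_left, inner_sub_left, real_inner_smul_left, real_inner_smul_left,
      real_inner_self_eq_norm_sq, U.norm_eq_one, real_inner_comm, horth, mul_pow, hsq]
    ring
  have ek : ⟪ξ, U k⟫_ℝ ^ 2 = a ^ 2 / S := by
    rw [hξ, real_inner_smul_left, inner_sub_left, real_inner_smul_left, real_inner_smul_left,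
      real_inner_self_eq_norm_sq, U.norm_eq_one, horth, mul_pow, hsq]
    ring
  have ej : ∀ j, j ≠ i ∧ j ≠ k → ⟪ξ, U j⟫_ℝ = 0 := by
    rintro j ⟨hji, hjk⟩
    rw [hξ, real_inner_smul_left, inner_sub_left, real_inner_smul_left, real_inner_smul_left,
      U.orthonormal.2 hji.symm, U.orthonormal.2 hjk.symm]
    ring
  have esum : ∑ j, (h' (⟪v, U j⟫_ℝ ^ 2 / w j) * (⟪ξ, U j⟫_ℝ ^ 2 - ⟪v, U j⟫_ℝ ^ 2) +
      2 * cmin * (⟪v, U j⟫_ℝ ^ 2 * ⟪ξ, U j⟫_ℝ ^ 2 / w j)) =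
      ((h' (a ^ 2 / w i) - μ) * (b ^ 2 / S) + 2 * cmin * (a ^ 2 * (b ^ 2 / S) / w i)) +
      ((h' (b ^ 2 / w k) - μ) * (a ^ 2 / S) + 2 * cmin * (b ^ 2 * (a ^ 2 / S) / w k)) := by
    calc _ = ∑ j, ((h' (⟪v, U j⟫_ℝ ^ 2 / w j) - μ) * ⟪ξ, U j⟫_ℝ ^ 2 +
          2 * cmin * (⟪v, U j⟫_ℝ ^ 2 * ⟪ξ, U j⟫_ℝ ^ 2 / w j)) := by
          simp only [mul_sub, sub_mul, Finset.sum_add_distrib, Finset.sum_sub_distrib,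
            ← Finset.mul_sum, hξsum, mul_one, ← hμ]
      _ = _ := by
          rw [Fintype.sum_eq_add i k hik fun j hj => by rw [ej j hj]; ring, ei, ek]
  rw [esum] at key
  have hba : b ^ 2 ≤ a ^ 2 := sq_le_sq.2 hle
  have hb1 : |b| ≤ 1 := by
    have := abs_real_inner_le_norm v (U k)
    rwa [hvn, U.norm_eq_one, mul_one] at this
  -- first-order part
  have g1 : -(6 * cmax * R ^ 3 * ε) ≤ |b| * (h' (a ^ 2 / w i) - μ) := by
    have : |b| * |h' (a ^ 2 / w i) - μ| ≤ 6 * cmax * R ^ 3 * ε := le_trans (by gcongr) gi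
    rw [← abs_abs b, ← abs_mul] at this
    exact (abs_le.1 this).1
  have g2 : -(6 * cmax * R ^ 3 * ε) ≤ |b| * (h' (b ^ 2 / w k) - μ) := by
    have := gk
    rw [← abs_abs b, ← abs_mul] at this
    exact (abs_le.1 this).1
  have q1 : 0 ≤ b ^ 2 / S := by positivity
  have q2 : 0 ≤ a ^ 2 / S := by positivity
  have q3 : b ^ 2 / S + a ^ 2 / S = 1 := by rw [← add_div, hS, add_comm]; exact div_self hS0.ne'
  have q4 : 1 / 2 ≤ a ^ 2 / S := by
    rw [div_le_div_iff₀ (by norm_num) hS0]; rw [hS]; linarith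
  -- second-order part
  have r : ∀ j, b ^ 2 * (1 / 2) / W ≤ b ^ 2 * (a ^ 2 / S) / w j := fun j =>
    div_le_div₀ (by positivity) (by gcongr) (hx.pos j) (hW j)
  have r1 := r i
  have r2 := r k
  have e1 : a ^ 2 * (b ^ 2 / S) / w i = b ^ 2 * (a ^ 2 / S) / w i := by ring
  rw [e1] at key
  have key' := mul_le_mul_of_nonneg_left key hb0.le
  have f1 := mul_le_mul_of_nonneg_right g1 q1
  have f2 := mul_le_mul_of_nonneg_right g2 q2
  have f3 : 2 * cmin * |b| * (b ^ 2 / W) ≤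
      2 * cmin * |b| * (b ^ 2 * (a ^ 2 / S) / w i + b ^ 2 * (a ^ 2 / S) / w k) := by
    gcongr
    calc b ^ 2 / W = b ^ 2 * (1 / 2) / W + b ^ 2 * (1 / 2) / W := by ring
      _ ≤ _ := add_le_add r1 r2
  have f4 : |b| * (16 * cmax * R ^ 3 * ε) ≤ 16 * cmax * R ^ 3 * ε :=
    mul_le_of_le_one_left (by positivity) hb1
  have f5 : 2 * cmin * |b| * (b ^ 2 / W) ≤ 22 * cmax * R ^ 3 * ε := by
    have e3 : -(6 * cmax * R ^ 3 * ε) * (b ^ 2 / S) + -(6 * cmax * R ^ 3 * ε) * (a ^ 2 / S)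
        = -(6 * cmax * R ^ 3 * ε) := by rw [← mul_add, q3, mul_one]
    linarith
  have e4 : 2 * cmin * |b| * (b ^ 2 / W) = 2 * (cmin * |b| ^ 3) / W := by
    rw [← sq_abs b]; ring
  rw [e4, div_le_iff₀ hW0] at f5
  linarith

theorem exists_near_of_isSphereLocalMax (hx : IsClusterEmbedding w U c x)
    (hh : IsPinched cmin cmax h h') (hxy : IsCloseEmbedding R ε x y) (hε : 0 ≤ ε) (hR : 0 ≤ R)
    {W B : ℝ} (hW : ∀ j, w j ≤ W) (hB : 0 ≤ B)
    (hWB : 11 * cmax * R ^ 3 * ε * W ≤ cmin * B ^ 3) {v : EuclideanSpace ℝ (Fin m)}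
    (hv : IsSphereLocalMax (fun u => 𝔼 i, h (⟪u, y i⟫_ℝ ^ 2)) v) :
    ∃ i, ∃ s ∈ ({1, -1} : Set ℝ), ‖s • U i - v‖ ^ 2 ≤ 2 * (Fintype.card ι * B ^ 2) := by
  classical
  have hvn : ‖v‖ = 1 := by simpa using hv.1
  have hsum := U.sum_sq_inner_eq_one hvn
  have hne : Nonempty ι := by
    by_contra hne
    rw [not_nonempty_iff] at hne
    simp at hsum
  obtain ⟨i, hi⟩ := Finite.exists_max fun j => |⟪v, U j⟫_ℝ|
  have hk : ∀ k, k ≠ i → ⟪v, U k⟫_ℝ ^ 2 ≤ B ^ 2 := by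
    intro k hk
    have h3 := (hx.coord_pow_three_le hh hxy hε hR hW hv hk.symm (hi k)).trans hWB
    have h4 : |⟪v, U k⟫_ℝ| ^ 3 ≤ B ^ 3 := le_of_mul_le_mul_left h3 hh.cmin_pos
    rw [← sq_abs]
    have := le_of_pow_le_pow_left₀ three_ne_zero hB h4
    gcongr
  have hrest : 1 - ⟪v, U i⟫_ℝ ^ 2 ≤ Fintype.card ι * B ^ 2 := by
    have e := Finset.add_sum_erase Finset.univ (fun j => ⟪v, U j⟫_ℝ ^ 2) (Finset.mem_univ i)
    rw [hsum] at e
    calc 1 - ⟪v, U i⟫_ℝ ^ 2 = ∑ j ∈ Finset.univ.erase i, ⟪v, U j⟫_ℝ ^ 2 := by linarith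
      _ ≤ ∑ j ∈ Finset.univ.erase i, B ^ 2 :=
        Finset.sum_le_sum fun k hk' => hk k (Finset.ne_of_mem_erase hk')
      _ ≤ ∑ j : ι, B ^ 2 :=
        Finset.sum_le_sum_of_subset_of_nonneg (Finset.erase_subset _ _) fun _ _ _ => sq_nonneg B
      _ = _ := by simp
  rcases le_total 0 ⟪v, U i⟫_ℝ with h0 | h0
  · exact ⟨i, 1, by simp, (U.norm_smul_sub_sq_le hvn (by simp) (by linarith)).trans (by linarith)⟩
  · exact ⟨i, -1, by simp, (U.norm_smul_sub_sq_le hvn (by simp) (by linarith)).trans (by linarith)⟩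

/-- Near `± U i` the unperturbed function drops linearly in `1 - ⟨u, U i⟩²`. The slope compares the
secants of `h` over `[0, 1/wᵢ]` and `[0, 1/(2wᵢ)]`, so it does not see the upper bound on `h''`. -/
theorem value_le (hx : IsClusterEmbedding w U c x) (hh : IsPinched cmin cmax h h') {W w₀ : ℝ}
    (hw₀ : 0 < w₀) (hw : ∀ j, w₀ ≤ w j) (hW : ∀ j, w j ≤ W) {i : ι} {s : ℝ}
    (hs : s ∈ ({1, -1} : Set ℝ)) {u : EuclideanSpace ℝ (Fin m)} (hu : ‖u‖ = 1)
    (hcap : 1 - ⟪u, U i⟫_ℝ ^ 2 ≤ w₀ / (2 * W)) :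
    ∑ j, w j * h (⟪u, U j⟫_ℝ ^ 2 / w j) + cmin / (4 * W) * (1 - ⟪u, U i⟫_ℝ ^ 2) ≤
      ∑ j, w j * h (⟪s • U i, U j⟫_ℝ ^ 2 / w j) := by
  classical
  have hs2 : s ^ 2 = 1 := by
    rcases hs with rfl | hs
    · norm_num
    · rw [Set.mem_singleton_iff.1 hs]; norm_num
  have hc := hh.cmin_pos
  have hwi := hx.pos i
  have hW0 : 0 < W := hwi.trans_le (hW i)
  have hsum := U.sum_sq_inner_eq_one hu
  have e := Finset.add_sum_erase Finset.univ (fun j => ⟪u, U j⟫_ℝ ^ 2) (Finset.mem_univ i)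
  rw [hsum] at e
  set τ := 1 - ⟪u, U i⟫_ℝ ^ 2 with hτ
  have hτe : τ = ∑ j ∈ Finset.univ.erase i, ⟪u, U j⟫_ℝ ^ 2 := by linarith
  have hτ0 : 0 ≤ τ := by rw [hτe]; exact Finset.sum_nonneg fun _ _ => sq_nonneg _
  have hτ1 : τ ≤ 1 := by rw [hτ]; linarith [sq_nonneg ⟪u, U i⟫_ℝ]
  set z := 1 / (2 * w i) with hz
  have hz0 : 0 < z := by positivity
  have hrest : ∀ j ∈ Finset.univ.erase i, w j * h (⟪u, U j⟫_ℝ ^ 2 / w j) ≤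
      w j * h 0 + 2 * w i * (h z - h 0) * ⟪u, U j⟫_ℝ ^ 2 := by
    intro j hj
    have hwj := hx.pos j
    have hjτ : ⟪u, U j⟫_ℝ ^ 2 ≤ τ := by
      rw [hτe]
      exact Finset.single_le_sum (f := fun j => ⟪u, U j⟫_ℝ ^ 2) (fun _ _ => sq_nonneg _) hj
    set l := 2 * w i * ⟪u, U j⟫_ℝ ^ 2 / w j with hl
    have hl0 : 0 ≤ l := by positivity
    have hl1 : l ≤ 1 := by
      rw [hl, div_le_one hwj]
      calc 2 * w i * ⟪u, U j⟫_ℝ ^ 2 ≤ 2 * W * (w₀ / (2 * W)) := by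
            gcongr
            · exact hW i
            · exact hjτ.trans hcap
        _ = w₀ := by field_simp
        _ ≤ w j := hw j
    have hlz : l * z = ⟪u, U j⟫_ℝ ^ 2 / w j := by rw [hl, hz]; field_simp
    have := mul_le_mul_of_nonneg_left (hh.le_of_mem_segment hl0 hl1 z) hwj.le
    rw [hlz] at this
    refine this.trans_eq ?_
    rw [hl]; field_simp; ring
  have hmain : w i * h (⟪u, U i⟫_ℝ ^ 2 / w i) ≤
      w i * h (1 / w i) - τ * w i * (h (1 / w i) - h 0) := by
    have := mul_le_mul_of_nonneg_left
      (hh.le_of_mem_segment (sub_nonneg.2 hτ1) (by linarith) (1 / w i)) hwi.le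
    have e1 : (1 - τ) * (1 / w i) = ⟪u, U i⟫_ℝ ^ 2 / w i := by rw [hτ]; ring
    rw [e1] at this
    linarith
  have hL : ∑ j, w j * h (⟪u, U j⟫_ℝ ^ 2 / w j) ≤
      w i * h (1 / w i) - τ * w i * (h (1 / w i) - h 0) +
      (∑ j ∈ Finset.univ.erase i, w j * h 0 + 2 * w i * (h z - h 0) * τ) := by
    rw [← Finset.add_sum_erase _ _ (Finset.mem_univ i)]
    refine add_le_add hmain ((Finset.sum_le_sum hrest).trans_eq ?_)
    rw [Finset.sum_add_distrib, ← Finset.mul_sum, ← hτe]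
  have hRr : ∑ j, w j * h (⟪s • U i, U j⟫_ℝ ^ 2 / w j) =
      w i * h (1 / w i) + ∑ j ∈ Finset.univ.erase i, w j * h 0 := by
    rw [← Finset.add_sum_erase _ _ (Finset.mem_univ i)]
    congr 1
    · rw [real_inner_smul_left, real_inner_self_eq_norm_sq, U.norm_eq_one, mul_pow, hs2]; norm_num
    · refine Finset.sum_congr rfl fun j hj => ?_
      rw [real_inner_smul_left, U.orthonormal.2 (Finset.ne_of_mem_erase hj).symm]; norm_num
  have hgap := hh.midpoint_gap z
  have h2z : 2 * z = 1 / w i := by rw [hz]; field_simp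
  rw [h2z] at hgap
  have hg : cmin / (4 * W) ≤ w i * (h (1 / w i) - 2 * h z + h 0) := by
    calc cmin / (4 * W) ≤ cmin / (4 * w i) := by gcongr; exact hW i
      _ = w i * (cmin * z ^ 2) := by rw [hz]; field_simp; ring
      _ ≤ _ := by gcongr
  have hg' := mul_le_mul_of_nonneg_right hg hτ0
  rw [hRr]
  linarith

theorem exists_isSphereLocalMax_near (hx : IsClusterEmbedding w U c x)
    (hh : IsPinched cmin cmax h h') (hxy : IsCloseEmbedding R ε x y) (hε : 0 ≤ ε) (hR : 0 ≤ R)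
    {W w₀ τ : ℝ} (hw₀ : 0 < w₀) (hw : ∀ j, w₀ ≤ w j) (hW : ∀ j, w j ≤ W)
    (hτ : 16 * cmax * R ^ 3 * ε * W ≤ cmin * τ) (hτ1 : τ < w₀ / (2 * W)) (i : ι) {s : ℝ}
    (hs : s ∈ ({1, -1} : Set ℝ)) :
    ∃ v, IsSphereLocalMax (fun u => 𝔼 i, h (⟪u, y i⟫_ℝ ^ 2)) v ∧ ‖s • U i - v‖ ^ 2 ≤ 2 * τ := by
  have hs2 : s ^ 2 = 1 := by
    rcases hs with rfl | hs
    · norm_num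
    · rw [Set.mem_singleton_iff.1 hs]; norm_num
  have hc := hh.cmin_pos
  have hW0 : 0 < W := (hx.pos i).trans_le (hW i)
  set F : EuclideanSpace ℝ (Fin m) → ℝ := fun u => 𝔼 i, h (⟪u, y i⟫_ℝ ^ 2) with hF
  have hFc : Continuous F := by
    have hhc := hh.cont
    have : F = fun u => (∑ i, h (⟪u, y i⟫_ℝ ^ 2)) / (Fintype.card (Fin n) : ℝ) :=
      funext fun u => Fintype.expect_eq_sum_div_card _
    rw [this]
    fun_prop
  have hgc : Continuous fun u : EuclideanSpace ℝ (Fin m) => ⟪u, U i⟫_ℝ := by fun_prop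
  set t := w₀ / (2 * W) with ht
  have ht0 : 0 < t := by positivity
  have ht1 : t ≤ 1 / 2 := by
    rw [ht, div_le_div_iff₀ (by positivity) (by norm_num)]
    linarith [(hw i).trans (hW i)]
  -- maximize over a cap around `s • U i`, and see that the maximum is not on its boundary
  set K : Set (EuclideanSpace ℝ (Fin m)) :=
    Metric.sphere 0 1 ∩ {u | 0 ≤ s * ⟪u, U i⟫_ℝ ∧ 1 - t ≤ ⟪u, U i⟫_ℝ ^ 2} with hK
  have hKc : IsCompact K := by
    refine (isCompact_sphere _ _).inter_right (IsClosed.inter ?_ ?_)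
    · exact isClosed_le continuous_const (continuous_const.mul hgc)
    · exact isClosed_le continuous_const (hgc.pow 2)
  have hse : ⟪s • U i, U i⟫_ℝ = s := by
    rw [real_inner_smul_left, real_inner_self_eq_norm_sq, U.norm_eq_one]; ring
  have hsn : ‖s • U i‖ = 1 := by
    rw [norm_smul, U.norm_eq_one, mul_one, Real.norm_eq_abs]
    rw [← sq_abs] at hs2
    exact (pow_eq_one_iff_of_nonneg (abs_nonneg s) two_ne_zero).1 hs2
  have hsK : s • U i ∈ K := by
    refine ⟨by simpa using hsn, ?_, ?_⟩
    · rw [hse]; nlinarith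
    · rw [hse, hs2]; linarith
  obtain ⟨v, hvK, hvmax⟩ := hKc.exists_isMaxOn ⟨_, hsK⟩ hFc.continuousOn
  have hvn : ‖v‖ = 1 := by simpa using hvK.1
  have h1 : F (s • U i) ≤ F v := hvmax hsK
  have h2 := hx.value_le hh hw₀ hw hW hs hvn (by linarith [hvK.2.2] : _ ≤ t)
  have h3 := hx.abs_value_sub_le hh hxy hε hR hvn
  have h4 := hx.abs_value_sub_le hh hxy hε hR hsn
  have h5 : cmin / (4 * W) * (1 - ⟪v, U i⟫_ℝ ^ 2) ≤ 4 * cmax * R ^ 3 * ε := by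
    have a3 := (abs_le.1 h3).1
    have a4 := (abs_le.1 h4).2
    simp only [hF] at h1
    linarith
  have h6 : 1 - ⟪v, U i⟫_ℝ ^ 2 ≤ τ := by
    have e : cmin / (4 * W) * (1 - ⟪v, U i⟫_ℝ ^ 2) = cmin * (1 - ⟪v, U i⟫_ℝ ^ 2) / (4 * W) := by
      ring
    rw [e, div_le_iff₀ (by positivity)] at h5
    refine le_of_mul_le_mul_left ?_ hc
    linarith
  have hpos : 0 < s * ⟪v, U i⟫_ℝ := by
    refine lt_of_le_of_ne hvK.2.1 fun h0 => ?_
    have : (s * ⟪v, U i⟫_ℝ) ^ 2 = 0 := by rw [← h0]; norm_num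
    rw [mul_pow, hs2] at this
    linarith
  refine ⟨v, ⟨hvK.1, ?_⟩, ?_⟩
  · have o1 : ∀ᶠ u in 𝓝 v, 0 < s * ⟪u, U i⟫_ℝ :=
      (continuous_const.mul hgc).continuousAt.eventually (lt_mem_nhds hpos)
    have o2 : ∀ᶠ u in 𝓝 v, 1 - t < ⟪u, U i⟫_ℝ ^ 2 :=
      (hgc.pow 2).continuousAt.eventually (lt_mem_nhds (by simp only [Pi.pow_apply]; linarith))
    filter_upwards [o1.filter_mono nhdsWithin_le_nhds, o2.filter_mono nhdsWithin_le_nhds,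
      self_mem_nhdsWithin] with u hu1 hu2 hu3
    exact hvmax ⟨hu3, hu1.le, hu2.le⟩
  · exact (U.norm_smul_sub_sq_le hvn hs hvK.2.1).trans (by linarith)

end IsClusterEmbedding

end Location

/-! ### The null space of the Laplacian -/

namespace SimilarityGraph

variable {n m : ℕ} (G : SimilarityGraph n)

theorem eq_of_reachable_of_laplacian_mulVec_eq_zero {x : Fin n → ℝ} (hx : G.laplacian *ᵥ x = 0)
    {i j : Fin n} (hij : G.graph.Reachable i j) : x i = x j := by
  -- the Dirichlet form `∑ aᵢⱼ (xᵢ - xⱼ)²` vanishes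
  have h1 : ∑ i, ∑ j, G.weight i j * (x i * (x i - x j)) = 0 := by
    have h0 : x ⬝ᵥ (G.laplacian *ᵥ x) = 0 := by rw [hx, dotProduct_zero]
    rw [← h0]
    simp only [laplacian, Matrix.sub_mulVec, dotProduct, Pi.sub_apply, Matrix.mulVec_diagonal]
    refine Finset.sum_congr rfl fun i _ => ?_
    rw [Matrix.mulVec, dotProduct, mul_sub, Finset.sum_mul, Finset.mul_sum, Finset.mul_sum,
      ← Finset.sum_sub_distrib]
    exact Finset.sum_congr rfl fun j _ => by ring
  have h2 : ∑ i, ∑ j, G.weight i j * (x j * (x j - x i)) = 0 := by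
    rw [Finset.sum_comm, ← h1]
    refine Finset.sum_congr rfl fun i _ => Finset.sum_congr rfl fun j _ => ?_
    rw [G.symm.apply]
  have h3 : ∑ i, ∑ j, G.weight i j * (x i - x j) ^ 2 = 0 := by
    rw [← add_zero (0 : ℝ)]
    nth_rewrite 1 [← h1]
    rw [← h2, ← Finset.sum_add_distrib]
    refine Finset.sum_congr rfl fun i _ => ?_
    rw [← Finset.sum_add_distrib]
    exact Finset.sum_congr rfl fun j _ => by ring
  have hnn : ∀ i j, 0 ≤ G.weight i j * (x i - x j) ^ 2 :=
    fun i j => mul_nonneg (G.nonneg i j) (sq_nonneg _)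
  have h4 : ∀ i j, G.weight i j * (x i - x j) ^ 2 = 0 := by
    intro i j
    have a := (Finset.sum_eq_zero_iff_of_nonneg
      fun i _ => Finset.sum_nonneg fun j _ => hnn i j).1 h3 i (Finset.mem_univ i)
    exact (Finset.sum_eq_zero_iff_of_nonneg fun j _ => hnn i j).1 a j (Finset.mem_univ j)
  obtain ⟨p⟩ := hij
  induction p with
  | nil => rfl
  | cons hadj _ ih =>
    rw [← ih]
    have := (mul_eq_zero.1 (h4 _ _)).resolve_left hadj.2.ne'
    exact sub_eq_zero.1 (pow_eq_zero_iff two_ne_zero |>.1 this)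

theorem componentWeight_pos (c : G.graph.ConnectedComponent) : 0 < G.componentWeight c := by
  obtain ⟨v, hv⟩ := c.nonempty_supp
  have : Nonempty c.supp := ⟨⟨v, hv⟩⟩
  have h1 : 0 < Nat.card c.supp := Nat.card_pos
  have h2 : 0 < n := Fin.pos v
  unfold componentWeight
  positivity

theorem componentWeight_le_one (c : G.graph.ConnectedComponent) : G.componentWeight c ≤ 1 := by
  have h1 : Nat.card c.supp ≤ n := by
    have := Nat.card_le_card_of_injective (Subtype.val : c.supp → Fin n) Subtype.val_injective
    rwa [Nat.card_fin] at this
  exact div_le_one_of_le₀ (by exact_mod_cast h1) (Nat.cast_nonneg n)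

theorem wMin_le (c : G.graph.ConnectedComponent) : G.wMin ≤ G.componentWeight c :=
  ciInf_le (Set.finite_range _).bddBelow c

theorem le_wMax (c : G.graph.ConnectedComponent) : G.componentWeight c ≤ G.wMax :=
  le_ciSup (Set.finite_range _).bddAbove c

theorem wMin_pos [Nonempty G.graph.ConnectedComponent] : 0 < G.wMin := by
  obtain ⟨c, hc⟩ := exists_eq_ciInf_of_finite (f := G.componentWeight)
  rw [wMin, ← hc]
  exact G.componentWeight_pos c

theorem expect_componentWeight [Fintype G.graph.ConnectedComponent]
    (f : G.graph.ConnectedComponent → ℝ) :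
    𝔼 i, f (G.graph.connectedComponentMk i) = ∑ c, G.componentWeight c * f c := by
  classical
  rw [Fintype.expect_eq_sum_div_card, Fintype.card_fin, Finset.sum_div,
    ← Finset.sum_fiberwise Finset.univ G.graph.connectedComponentMk]
  refine Finset.sum_congr rfl fun c _ => ?_
  have hcard : Nat.card c.supp = (Finset.univ.filter
      fun i => G.graph.connectedComponentMk i = c).card := by
    rw [← Nat.card_eq_finsetCard]
    exact Nat.card_congr (Equiv.subtypeEquivRight fun i => by
      simp [SimpleGraph.ConnectedComponent.mem_supp_iff])
  rw [Finset.sum_congr rfl (g := fun _ => f c / n) (fun i hi => by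
    rw [(Finset.mem_filter.1 hi).2]), Finset.sum_const, nsmul_eq_mul, componentWeight, hcard]
  ring

/-- The rows of a scaled orthogonal basis of the null space form an ideal cluster embedding: they
are constant on components, and `XᵀX = n` becomes `MᵀM = 1` for the square matrix `M` with rows
`√w_c` times the common row of the component `c`, whence `MMᵀ = 1`. -/
theorem exists_isClusterEmbedding [Fintype G.graph.ConnectedComponent]
    (hm : Nat.card G.graph.ConnectedComponent = m) {X : Matrix (Fin n) (Fin m) ℝ}
    (hn : 0 < n) (hX : IsScaledNullBasis G.laplacian X) :
    ∃ U : OrthonormalBasis G.graph.ConnectedComponent ℝ (EuclideanSpace ℝ (Fin m)),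
      IsClusterEmbedding G.componentWeight U G.graph.connectedComponentMk (embeddedPoint X) := by
  classical
  have hcol : ∀ a, G.laplacian *ᵥ X.col a = 0 := by
    intro a
    have : X.col a ∈ LinearMap.ker G.laplacian.mulVecLin := by
      rw [← hX.2]; exact Submodule.subset_span ⟨a, rfl⟩
    simpa using this
  choose r hr using fun c : G.graph.ConnectedComponent => c.nonempty_supp
  have hconst : ∀ i a, X i a = X (r (G.graph.connectedComponentMk i)) a := by
    intro i a
    refine G.eq_of_reachable_of_laplacian_mulVec_eq_zero (hcol a) ?_
    exact (SimpleGraph.ConnectedComponent.exact (hr (G.graph.connectedComponentMk i))).symm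
  set M : Matrix G.graph.ConnectedComponent (Fin m) ℝ :=
    fun c a => √(G.componentWeight c) * X (r c) a with hM
  have hn' : (n : ℝ) ≠ 0 := by positivity
  have hMM : Mᵀ * M = 1 := by
    ext a b
    have h1 := congrFun (congrFun hX.1 a) b
    rw [Matrix.mul_apply] at h1 ⊢
    have h2 := G.expect_componentWeight fun c => X (r c) a * X (r c) b
    simp only [← hconst] at h2
    rw [Fintype.expect_eq_sum_div_card, Fintype.card_fin] at h2
    have h3 : ∑ c, Mᵀ a c * M c b = ∑ c, G.componentWeight c * (X (r c) a * X (r c) b) := by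
      refine Finset.sum_congr rfl fun c _ => ?_
      have hw := Real.mul_self_sqrt (G.componentWeight_pos c).le
      rw [Matrix.transpose_apply]
      linear_combination (X (r c) a * X (r c) b) * hw
    rw [h3, ← h2]
    simp only [Matrix.transpose_apply, Matrix.smul_apply, smul_eq_mul] at h1
    rw [h1]
    field_simp
  have hcard : Fintype.card G.graph.ConnectedComponent = m := by
    rw [← hm, Nat.card_eq_fintype_card]
  have hMM' : M * Mᵀ = 1 :=
    (Matrix.mul_eq_one_comm_of_card_eq _ _ _ (by simpa using hcard.symm)).1 hMM
  have hon : Orthonormal ℝ fun c => (WithLp.toLp 2 (M c) : EuclideanSpace ℝ (Fin m)) := by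
    rw [orthonormal_iff_ite]
    intro c d
    have := congrFun (congrFun hMM' d) c
    rw [Matrix.mul_apply, Matrix.one_apply] at this
    simp only [PiLp.inner_apply, RCLike.inner_apply, conj_trivial]
    simp only [Matrix.transpose_apply] at this
    rw [this]
    simp only [eq_comm]
  obtain ⟨U, hU⟩ := Orthonormal.exists_orthonormalBasis_extension_of_card_eq
    (v := fun c => (WithLp.toLp 2 (M c) : EuclideanSpace ℝ (Fin m))) (s := Set.univ)
    (by simpa using hcard.symm) (hon.comp _ Subtype.val_injective)
  refine ⟨U, G.componentWeight_pos, fun i => ?_, G.expect_componentWeight⟩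
  rw [hU _ (Set.mem_univ _)]
  have h0 := (Real.sqrt_pos.2 (G.componentWeight_pos (G.graph.connectedComponentMk i))).ne'
  ext a
  simp only [embeddedPoint, Matrix.row, hM, PiLp.smul_apply, smul_eq_mul]
  rw [inv_mul_cancel_left₀ h0]
  exact hconst i a

end SimilarityGraph

/-! ### From the spectral norm to directional closeness -/

section Norms

variable {n m : ℕ}

theorem norm_toLp_mulVec_le (M : Matrix (Fin n) (Fin m) ℝ) (u : EuclideanSpace ℝ (Fin m)) :
    ‖(WithLp.toLp 2 (M *ᵥ u.ofLp) : EuclideanSpace ℝ (Fin n))‖ ≤ ‖M‖ * ‖u‖ :=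
  Matrix.l2_opNorm_mulVec M u

theorem inner_embeddedPoint (X : Matrix (Fin n) (Fin m) ℝ) (u : EuclideanSpace ℝ (Fin m))
    (i : Fin n) : ⟪u, embeddedPoint X i⟫_ℝ = (X *ᵥ u.ofLp) i := by
  simp [embeddedPoint, PiLp.inner_apply, Matrix.mulVec, dotProduct]

theorem abs_inner_sub_inner_embeddedPoint_le (X Y : Matrix (Fin n) (Fin m) ℝ)
    (u : EuclideanSpace ℝ (Fin m)) (i : Fin n) :
    |⟪u, embeddedPoint X i⟫_ℝ - ⟪u, embeddedPoint Y i⟫_ℝ| ≤ ‖X - Y‖ * ‖u‖ := by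
  rw [inner_embeddedPoint, inner_embeddedPoint, ← Pi.sub_apply, ← Matrix.sub_mulVec]
  exact (PiLp.norm_apply_le (WithLp.toLp 2 ((X - Y) *ᵥ u.ofLp) : EuclideanSpace ℝ (Fin n)) i).trans
    (norm_toLp_mulVec_le _ _)

theorem expect_abs_inner_sub_inner_embeddedPoint_le (X Y : Matrix (Fin n) (Fin m) ℝ)
    (u : EuclideanSpace ℝ (Fin m)) :
    𝔼 i, |⟪u, embeddedPoint X i⟫_ℝ - ⟪u, embeddedPoint Y i⟫_ℝ| ≤
      1 / √(n : ℝ) * ‖X - Y‖ * ‖u‖ := by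
  have h1 := norm_toLp_mulVec_le (X - Y) u
  set d := (X - Y) *ᵥ u.ofLp with hd
  have h2 : ∀ i, ⟪u, embeddedPoint X i⟫_ℝ - ⟪u, embeddedPoint Y i⟫_ℝ = d i := fun i => by
    rw [inner_embeddedPoint, inner_embeddedPoint, ← Pi.sub_apply, ← Matrix.sub_mulVec]
  simp only [h2]
  rcases Nat.eq_zero_or_pos n with rfl | hn
  · simp
  have hs : 0 < √(n : ℝ) := Real.sqrt_pos.2 (by exact_mod_cast hn)
  have hss : √(n : ℝ) * √(n : ℝ) = n := Real.mul_self_sqrt (Nat.cast_nonneg n)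
  have h3 : ∑ i, |d i| ≤ √(n : ℝ) * ‖(WithLp.toLp 2 d : EuclideanSpace ℝ (Fin n))‖ := by
    rw [EuclideanSpace.norm_eq, ← Real.sqrt_mul (Nat.cast_nonneg n)]
    refine Real.le_sqrt_of_sq_le ?_
    have := sq_sum_le_card_mul_sum_sq (s := (Finset.univ : Finset (Fin n))) (f := fun i => |d i|)
    simpa using this
  rw [Fintype.expect_eq_sum_div_card, Fintype.card_fin, div_le_iff₀ (by exact_mod_cast hn)]
  calc ∑ i, |d i| ≤ √(n : ℝ) * (‖X - Y‖ * ‖u‖) := h3.trans (by gcongr)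
    _ = 1 / √(n : ℝ) * ‖X - Y‖ * ‖u‖ * (√(n : ℝ) * √(n : ℝ)) := by field_simp
    _ = _ := by rw [hss]

theorem contrastFun_eq_expect (g : ℝ → ℝ) (X : Matrix (Fin n) (Fin m) ℝ) :
    contrastFun g X = fun u => 𝔼 i, (fun t => g (√|t|)) (⟪u, embeddedPoint X i⟫_ℝ ^ 2) := by
  funext u
  rw [contrastFun, Fintype.expect_eq_sum_div_card, Fintype.card_fin, one_div, inv_mul_eq_div]
  simp only [abs_pow, Real.sqrt_sq (abs_nonneg _)]

end Norms

namespace IsClusterEmbedding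

variable {n m : ℕ} {ι : Type*} [Fintype ι] {w : ι → ℝ}
  {U : OrthonormalBasis ι ℝ (EuclideanSpace ℝ (Fin m))} {c : Fin n → ι}
  {X Y : Matrix (Fin n) (Fin m) ℝ}

theorem isCloseEmbedding (hx : IsClusterEmbedding w U c (embeddedPoint X)) {w₀ E ε : ℝ}
    (hE : 0 ≤ E) (hw₀ : 0 < w₀) (hw₁ : w₀ ≤ 1) (hw : ∀ j, w₀ ≤ w j)
    (hXY : 1 / √(n : ℝ) * ‖X - Y‖ ≤ 4 * ε) (hXY' : ‖X - Y‖ ≤ 4 * E) :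
    IsCloseEmbedding ((1 + 4 * E) / √w₀) (4 * ε) (embeddedPoint X) (embeddedPoint Y) := by
  have hs0 : 0 < √w₀ := Real.sqrt_pos.2 hw₀
  have hs1 : √w₀ ≤ 1 := Real.sqrt_le_one.2 hw₁
  have hl : ∀ u i, |⟪u, embeddedPoint X i⟫_ℝ| ≤ 1 / √w₀ * ‖u‖ := by
    intro u i
    refine (abs_real_inner_le_norm _ _).trans ?_
    rw [hx.apply_eq, norm_smul, U.norm_eq_one, mul_one, norm_inv, Real.norm_eq_abs,
      abs_of_nonneg (Real.sqrt_nonneg _), mul_comm, ← one_div]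
    gcongr
    exact hw _
  have hR : 1 / √w₀ + 4 * E ≤ (1 + 4 * E) / √w₀ := by
    rw [add_div]
    gcongr
    rw [le_div_iff₀ hs0]
    exact mul_le_of_le_one_right (by positivity) hs1
  refine ⟨fun u i => (hl u i).trans ?_, fun u i => ?_, fun u => ?_⟩
  · gcongr; linarith
  · have h1 := abs_inner_sub_inner_embeddedPoint_le X Y u i
    have h2 := abs_sub_abs_le_abs_sub ⟪u, embeddedPoint Y i⟫_ℝ ⟪u, embeddedPoint X i⟫_ℝ
    rw [abs_sub_comm] at h2
    calc |⟪u, embeddedPoint Y i⟫_ℝ| ≤ 1 / √w₀ * ‖u‖ + ‖X - Y‖ * ‖u‖ := by linarith [hl u i]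
      _ ≤ 1 / √w₀ * ‖u‖ + 4 * E * ‖u‖ := by gcongr
      _ = (1 / √w₀ + 4 * E) * ‖u‖ := by ring
      _ ≤ _ := by gcongr
  · exact (expect_abs_inner_sub_inner_embeddedPoint_le X Y u).trans (by gcongr)

end IsClusterEmbedding

/-! ### Comparison of the error terms with the stated radius -/

section Radius

variable {cmin cmax D W w₀ : ℝ}

theorem sq_div_cube_le_sq_div_rpow (hw₀ : 0 < w₀) (hw₁ : w₀ ≤ 1) :
    W ^ 2 / w₀ ^ 3 ≤ W ^ 2 / w₀ ^ (7 / 2 : ℝ) := by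
  have h1 : w₀ ^ (7 / 2 : ℝ) ≤ w₀ ^ 3 := by
    rw [← Real.rpow_natCast w₀ 3]
    exact Real.rpow_le_rpow_of_exponent_ge hw₀ hw₁ (by norm_num)
  have h2 : 0 < w₀ ^ (7 / 2 : ℝ) := Real.rpow_pos_of_pos hw₀ _
  gcongr

theorem condition_mul_div_cube_le (hc : 0 < cmin) (hcc : cmin ≤ cmax) (hD : 0 < D)
    (hw₀ : 0 < w₀) (hw₁ : w₀ ≤ 1) :
    cmax / cmin * (W ^ 2 / w₀ ^ 3) ≤ (cmax + D) / cmin * (W ^ 2 / w₀ ^ (7 / 2 : ℝ)) := by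
  have h := sq_div_cube_le_sq_div_rpow (W := W) hw₀ hw₁
  have h0 : 0 < cmax := hc.trans_le hcc
  have h1 : cmax / cmin ≤ (cmax + D) / cmin := by gcongr; linarith
  have h2 : 0 ≤ W ^ 2 / w₀ ^ 3 := by positivity
  have h3 : 0 ≤ (cmax + D) / cmin := by positivity
  exact mul_le_mul h1 h h2 h3

theorem condition_mul_div_sq_le (hc : 0 < cmin) (hcc : cmin ≤ cmax) (hD : 0 < D)
    (hw₀ : 0 < w₀) (hw₁ : w₀ ≤ 1) (hW : w₀ ≤ W) :
    cmax / cmin * (W / w₀ ^ 2) ≤ (cmax + D) / cmin * (W ^ 2 / w₀ ^ (7 / 2 : ℝ)) := by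
  refine le_trans ?_ (condition_mul_div_cube_le hc hcc hD hw₀ hw₁)
  have h0 : 0 < cmax := hc.trans_le hcc
  have hW0 := hw₀.trans_le hW
  gcongr 1
  · rw [div_le_div_iff₀ (by positivity) (by positivity)]
    calc W * w₀ ^ 3 = W * w₀ ^ 2 * w₀ := by ring
      _ ≤ W * w₀ ^ 2 * W := by gcongr
      _ = _ := by ring

theorem div_sqrt_pow_three_le {E : ℝ} (hE : 0 ≤ E) (hw₀ : 0 < w₀) (hw₁ : w₀ ≤ 1) :
    ((1 + 4 * E) / √w₀) ^ 3 ≤ (1 + 4 * E) ^ 4 / w₀ ^ 2 := by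
  have hs0 : 0 < √w₀ := Real.sqrt_pos.2 hw₀
  have h1 : 1 ≤ (1 + 4 * E) / √w₀ := by
    rw [one_le_div hs0]
    exact (Real.sqrt_le_one.2 hw₁).trans (by linarith)
  calc ((1 + 4 * E) / √w₀) ^ 3 ≤ ((1 + 4 * E) / √w₀) ^ 4 := pow_le_pow_right₀ h1 (by norm_num)
    _ = (1 + 4 * E) ^ 4 / ((√w₀) ^ 2) ^ 2 := by rw [div_pow]; ring
    _ = _ := by rw [Real.sq_sqrt hw₀.le]

/-- No sign of `δ` is assumed: for `δ ≤ 0` the hypotheses force `η = 0`. -/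
theorem relative_perturbation_bounds {η δ A : ℝ} (hη : 0 ≤ η) (hA : 0 ≤ A) (hA2 : A ≤ 1 / 2)
    (h : η ≤ δ * A) : 0 ≤ η / δ ∧ η / δ ≤ A ∧ 2 * η / (δ - η) ≤ 4 * (η / δ) := by
  rcases le_or_gt δ 0 with hδ | hδ
  · have h0 : η = 0 := le_antisymm (h.trans (mul_nonpos_of_nonpos_of_nonneg hδ hA)) hη
    subst h0
    simpa using hA
  · refine ⟨by positivity, by rw [div_le_iff₀ hδ]; linarith, ?_⟩
    have h1 : δ / 2 ≤ δ - η := by nlinarith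
    calc 2 * η / (δ - η) ≤ 2 * η / (δ / 2) := by gcongr
      _ = 4 * (η / δ) := by ring

end Radius

/-! ### Maxima of the perturbed contrast -/

section Contrast

variable {n m : ℕ} {ι : Type*} [Fintype ι] {w : ι → ℝ}
  {U : OrthonormalBasis ι ℝ (EuclideanSpace ℝ (Fin m))} {c : Fin n → ι}
  {x y : Fin n → EuclideanSpace ℝ (Fin m)}

namespace IsClusterEmbedding

variable {cmin cmax D W w₀ E e : ℝ} {h h' : ℝ → ℝ}

/-- Local maxima lie within the radius of some `± U i`. With `|v_k| ≤ 44 (1 + 4E)⁴ e √Q` for all but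
one coordinate, the factor `128 ≥ 44 √2` is enough here; its size is dictated by existence. -/
theorem exists_norm_sub_le_radius (hx : IsClusterEmbedding w U c x)
    (hh : IsPinched cmin cmax h h') (hD : 0 < D) (hE : 0 ≤ E) (he : 0 ≤ e)
    (hw₀ : 0 < w₀) (hw₁ : w₀ ≤ 1) (hw : ∀ j, w₀ ≤ w j) (hW : ∀ j, w j ≤ W)
    (hxy : IsCloseEmbedding ((1 + 4 * E) / √w₀) (4 * e ^ 3) x y)
    {v : EuclideanSpace ℝ (Fin m)}
    (hv : IsSphereLocalMax (fun u => 𝔼 i, h (⟪u, y i⟫_ℝ ^ 2)) v) :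
    ∃ i, ∃ s ∈ ({1, -1} : Set ℝ), ‖s • U i - v‖ ≤ 128 * (1 + 4 * E) ^ 4 * e *
      √(Fintype.card ι * ((cmax + D) / cmin * (W ^ 2 / w₀ ^ (7 / 2 : ℝ)))) := by
  rcases isEmpty_or_nonempty ι with hι | ⟨⟨j₀⟩⟩
  · have := U.sum_sq_inner_eq_one (v := v) (by simpa using hv.1)
    simp at this
  have hwW := (hw j₀).trans (hW j₀)
  have hW0 := hw₀.trans_le hwW
  have hc := hh.cmin_pos
  have hc' := hc.trans_le hh.le_cmax
  have hP := condition_mul_div_sq_le hc hh.le_cmax hD hw₀ hw₁ hwW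
  set Q := (cmax + D) / cmin * (W ^ 2 / w₀ ^ (7 / 2 : ℝ)) with hQ
  set T := (1 + 4 * E) ^ 4 with hT
  have hT1 : 1 ≤ T := one_le_pow₀ (by linarith)
  have hQ1 : 1 ≤ Q := by
    refine le_trans ?_ hP
    refine one_le_mul_of_one_le_of_one_le (by rw [one_le_div hc]; exact hh.le_cmax) ?_
    rw [one_le_div (by positivity)]
    exact le_trans (by nlinarith) hwW
  have hQs : 1 ≤ √Q := Real.one_le_sqrt.2 hQ1
  have hQss : √Q ^ 2 = Q := Real.sq_sqrt (by linarith)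
  have hR := div_sqrt_pow_three_le hE hw₀ hw₁
  have hB : 11 * cmax * ((1 + 4 * E) / √w₀) ^ 3 * (4 * e ^ 3) * W ≤
      cmin * (44 * T * e * √Q) ^ 3 := by
    calc 11 * cmax * ((1 + 4 * E) / √w₀) ^ 3 * (4 * e ^ 3) * W ≤
          11 * cmax * (T / w₀ ^ 2) * (4 * e ^ 3) * W := by gcongr
      _ = cmin * (44 * T * e ^ 3 * (cmax / cmin * (W / w₀ ^ 2))) := by field_simp; ring
      _ ≤ cmin * ((44 * T) ^ 3 * e ^ 3 * √Q ^ 3) := by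
        have h1 : 44 * T ≤ (44 * T) ^ 3 := le_self_pow₀ (by linarith) (by norm_num)
        have h2 : cmax / cmin * (W / w₀ ^ 2) ≤ √Q ^ 3 := by
          calc _ ≤ Q := hP
            _ = √Q ^ 2 := hQss.symm
            _ ≤ √Q ^ 3 := pow_le_pow_right₀ hQs (by norm_num)
        gcongr
      _ = _ := by ring
  obtain ⟨i, s, hs, hd⟩ := hx.exists_near_of_isSphereLocalMax hh hxy (by positivity)
    (by positivity) hW (by positivity) hB hv
  refine ⟨i, s, hs, le_of_sq_le_sq (hd.trans ?_) (by positivity)⟩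
  have hN : (0 : ℝ) ≤ Fintype.card ι := Nat.cast_nonneg _
  rw [mul_pow _ (√(_ * Q)), Real.sq_sqrt (by positivity), mul_pow _ (√Q), hQss]
  have : 0 ≤ T ^ 2 * e ^ 2 * (Fintype.card ι * Q) := by positivity
  nlinarith

/-- Some local maximum lies within the radius of each `± U i`. If the radius is below `2`, the factor
`128` makes the bound on `1 - v_i²` smaller than the size `w₀ / (2W)` of the cap. -/
theorem exists_isSphereLocalMax_norm_sub_le_radius (hx : IsClusterEmbedding w U c x)
    (hh : IsPinched cmin cmax h h') (hD : 0 < D) (hE : 0 ≤ E) (he : 0 ≤ e) (he1 : e ≤ 1)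
    (hw₀ : 0 < w₀) (hw₁ : w₀ ≤ 1) (hw : ∀ j, w₀ ≤ w j) (hW : ∀ j, w j ≤ W)
    (hxy : IsCloseEmbedding ((1 + 4 * E) / √w₀) (4 * e ^ 3) x y) (i : ι) {s : ℝ}
    (hs : s ∈ ({1, -1} : Set ℝ)) :
    ∃ v, IsSphereLocalMax (fun u => 𝔼 i, h (⟪u, y i⟫_ℝ ^ 2)) v ∧
      ‖s • U i - v‖ ≤ 128 * (1 + 4 * E) ^ 4 * e *
        √(Fintype.card ι * ((cmax + D) / cmin * (W ^ 2 / w₀ ^ (7 / 2 : ℝ)))) := by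
  have hwW := (hw i).trans (hW i)
  have hW0 := hw₀.trans_le hwW
  have hc := hh.cmin_pos
  have hc' := hc.trans_le hh.le_cmax
  have hP := condition_mul_div_sq_le hc hh.le_cmax hD hw₀ hw₁ hwW
  have hP2 := condition_mul_div_cube_le (W := W) hc hh.le_cmax hD hw₀ hw₁
  have hN : (1 : ℝ) ≤ Fintype.card ι := by
    have : 0 < Fintype.card ι := Fintype.card_pos_iff.2 ⟨i⟩
    exact_mod_cast this
  set Q := (cmax + D) / cmin * (W ^ 2 / w₀ ^ (7 / 2 : ℝ)) with hQ
  have hQ0 : 0 < Q := by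
    have := Real.rpow_pos_of_pos hw₀ (7 / 2 : ℝ)
    positivity
  have hNQ : Q ≤ Fintype.card ι * Q := le_mul_of_one_le_left hQ0.le hN
  set T := (1 + 4 * E) ^ 4 with hT
  have hT1 : 1 ≤ T := one_le_pow₀ (by linarith)
  have hR := div_sqrt_pow_three_le hE hw₀ hw₁
  set ρ := 128 * T * e * √(Fintype.card ι * Q) with hρ
  have hρ0 : 0 ≤ ρ := by positivity
  have hρ2 : ρ ^ 2 = 16384 * T ^ 2 * e ^ 2 * (Fintype.card ι * Q) := by
    rw [hρ, mul_pow, Real.sq_sqrt (by positivity)]; ring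
  have hρQ : 16384 * T ^ 2 * e ^ 2 * Q ≤ ρ ^ 2 := by rw [hρ2]; gcongr
  have he3 : e ^ 3 ≤ e ^ 2 := pow_le_pow_of_le_one he he1 (by norm_num)
  have hTT : T ≤ T ^ 2 := le_self_pow₀ hT1 two_ne_zero
  have hsn : ‖s • U i‖ = 1 := by
    rw [norm_smul, U.norm_eq_one, mul_one]
    rcases hs with rfl | hs
    · norm_num
    · rw [Set.mem_singleton_iff.1 hs]; norm_num
  rcases le_or_gt 2 ρ with hbig | hsmall
  · -- the radius exceeds the diameter of the sphere, and a global maximum will do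
    have hFc : Continuous fun u : EuclideanSpace ℝ (Fin m) => 𝔼 i, h (⟪u, y i⟫_ℝ ^ 2) := by
      have hhc := hh.cont
      simp only [Fintype.expect_eq_sum_div_card]
      fun_prop
    obtain ⟨v, hv, hmax⟩ := (isCompact_sphere (0 : EuclideanSpace ℝ (Fin m)) 1).exists_isMaxOn
      ⟨s • U i, by simpa using hsn⟩ hFc.continuousOn
    have hvn : ‖v‖ = 1 := by simpa using hv
    refine ⟨v, ⟨hv, hmax.localize⟩, (norm_sub_le _ _).trans ?_⟩
    rw [hsn, hvn]; linarith
  · have hρ4 : ρ ^ 2 < 4 := by nlinarith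
    obtain ⟨v, hv, hd⟩ := hx.exists_isSphereLocalMax_near hh hxy (by positivity) (by positivity)
      hw₀ hw hW (τ := 64 * T * e ^ 3 * (cmax / cmin * (W / w₀ ^ 2))) (by
        calc 16 * cmax * ((1 + 4 * E) / √w₀) ^ 3 * (4 * e ^ 3) * W ≤
              16 * cmax * (T / w₀ ^ 2) * (4 * e ^ 3) * W := by gcongr
          _ = _ := by field_simp; ring) (by
        have h1 : T * e ^ 3 * (cmax / cmin * (W ^ 2 / w₀ ^ 3)) ≤ T ^ 2 * e ^ 2 * Q := by gcongr
        have h2 : 128 * (T * e ^ 3 * (cmax / cmin * (W ^ 2 / w₀ ^ 3))) < 1 := by linarith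
        rw [lt_div_iff₀ (by positivity)]
        calc _ = 128 * (T * e ^ 3 * (cmax / cmin * (W ^ 2 / w₀ ^ 3))) * w₀ := by
              field_simp; ring
          _ < 1 * w₀ := by gcongr
          _ = w₀ := one_mul _) i hs
    refine ⟨v, hv, le_of_sq_le_sq (hd.trans ?_) hρ0⟩
    have h1 : T * e ^ 3 * (cmax / cmin * (W / w₀ ^ 2)) ≤ T ^ 2 * e ^ 2 * Q := by gcongr
    have h2 : 0 ≤ T ^ 2 * e ^ 2 * Q := by positivity
    linarith

end IsClusterEmbedding

end Contrast

theorem mainTheorem5 (E : ℝ) (hE : 0 < E) :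
    ∃ C : ℝ, 0 < C ∧
      ∀ (n m : ℕ) (G : SimilarityGraph n)
        (_hm : Nat.card G.graph.ConnectedComponent = m) (hmn : m < n)
        (H : Matrix (Fin n) (Fin n) ℝ) (hH : H.IsHermitian)
        (X Xt : Matrix (Fin n) (Fin m) ℝ)
        (_hXt : IsLowestEigenvectors hmn.le (G.laplacian_isHermitian.add hH) Xt)
        (_hX : IsScaledNullBasis G.laplacian X)
        (_hXXt : 1 / √(n : ℝ) * ‖X - Xt‖ ≤ 2 * ‖H‖ / (G.eigengap m hmn - ‖H‖))
        (cmin cmax D : ℝ) (g : ℝ → ℝ) (_hg : IsRobustContrast cmin cmax D g)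
        (Z : Fin m → EuclideanSpace ℝ (Fin m)) (_hZ : Function.Injective Z)
        (_hZX : Set.range Z =
          Set.range fun i : Fin n => ‖embeddedPoint X i‖⁻¹ • embeddedPoint X i)
        (_hHsmall : ‖H‖ ≤ G.eigengap m hmn *
          min (E / √(n : ℝ))
            (min (G.wMin ^ (11 / 2 : ℝ) * cmin ^ 2 /
                (2048 * G.wMax ^ 5 * cmax * (1 + E) ^ 3)) (1 / 2))),
        (∀ i : Fin m, ∀ s ∈ ({1, -1} : Set ℝ),
          ∃ v, IsSphereLocalMax (contrastFun g Xt) v ∧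
            ‖s • Z i - v‖ ≤ C * (‖H‖ / G.eigengap m hmn) ^ (1 / 3 : ℝ) *
              √((cmax + D) * m / cmin * (G.wMax ^ 2 / G.wMin ^ (7 / 2 : ℝ)))) ∧
        (∀ v, IsSphereLocalMax (contrastFun g Xt) v →
          ∃ i : Fin m, ∃ s ∈ ({1, -1} : Set ℝ),
            ‖s • Z i - v‖ ≤ C * (‖H‖ / G.eigengap m hmn) ^ (1 / 3 : ℝ) *
              √((cmax + D) * m / cmin * (G.wMax ^ 2 / G.wMin ^ (7 / 2 : ℝ)))) := by
  refine ⟨128 * (1 + 4 * E) ^ 4, by positivity, ?_⟩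
  intro n m G hm hmn H hH X Xt _ hX hXXt cmin cmax D g hg Z _ hZX hHsmall
  classical
  have hn : 0 < n := (Nat.zero_le m).trans_lt hmn
  have hsn : 0 < √(n : ℝ) := Real.sqrt_pos.2 (by exact_mod_cast hn)
  have : Nonempty G.graph.ConnectedComponent := ⟨G.graph.connectedComponentMk ⟨0, hn⟩⟩
  have : Fintype G.graph.ConnectedComponent := Fintype.ofFinite _
  have hcard : (Fintype.card G.graph.ConnectedComponent : ℝ) = m := by
    rw [← hm, Nat.card_eq_fintype_card]
  obtain ⟨U, hU⟩ := G.exists_isClusterEmbedding hm hn hX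
  have hw₀ := G.wMin_pos
  have hw₁ : G.wMin ≤ 1 := (G.wMin_le (Classical.arbitrary _)).trans (G.componentWeight_le_one _)
  have hW₀ : 0 < G.wMax := (G.componentWeight_pos (Classical.arbitrary _)).trans_le (G.le_wMax _)
  have hc := hg.cmin_pos
  have hc' := hg.cmax_pos
  obtain ⟨hε0, hεA, hεd⟩ := relative_perturbation_bounds (norm_nonneg H)
    (le_min (by positivity) (le_min (by
      have := Real.rpow_nonneg hw₀.le (11 / 2 : ℝ)
      positivity) (by norm_num)))
    ((min_le_right _ _).trans (min_le_right _ _)) hHsmall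
  set ε := ‖H‖ / G.eigengap m hmn with hε
  have hεE : ε ≤ E / √(n : ℝ) := hεA.trans (min_le_left _ _)
  have hε1 : ε ≤ 1 := hεA.trans (((min_le_right _ _).trans (min_le_right _ _)).trans (by norm_num))
  set e := ε ^ (1 / 3 : ℝ) with he
  have he0 : 0 ≤ e := Real.rpow_nonneg hε0 _
  have he1 : e ≤ 1 := Real.rpow_le_one hε0 hε1 (by norm_num)
  have he3 : e ^ 3 = ε := by
    rw [he, ← Real.rpow_natCast, ← Real.rpow_mul hε0]; norm_num
  have hd := hXXt.trans hεd
  have hd' : ‖X - Xt‖ ≤ 4 * E := by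
    rw [one_div, inv_mul_le_iff₀ hsn] at hd
    rw [le_div_iff₀ hsn] at hεE
    linarith
  have hclose := hU.isCloseEmbedding hE.le hw₀ hw₁ G.wMin_le (he3 ▸ hd) hd'
  have hpin := hg.isPinched
  have hrad : (cmax + D) * m / cmin * (G.wMax ^ 2 / G.wMin ^ (7 / 2 : ℝ)) =
      Fintype.card G.graph.ConnectedComponent *
        ((cmax + D) / cmin * (G.wMax ^ 2 / G.wMin ^ (7 / 2 : ℝ))) := by
    rw [hcard]; ring
  -- the normalized rows of `X` are the basis vectors `U c`
  have hnormal : ∀ i, ‖embeddedPoint X i‖⁻¹ • embeddedPoint X i =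
      U (G.graph.connectedComponentMk i) := by
    intro i
    have h0 := Real.sqrt_pos.2 (hU.pos (G.graph.connectedComponentMk i))
    rw [hU.apply_eq, norm_smul, U.norm_eq_one, mul_one, norm_inv, Real.norm_eq_abs,
      abs_of_pos h0, inv_inv, smul_smul, mul_inv_cancel₀ h0.ne', one_smul]
  rw [hrad, contrastFun_eq_expect]
  refine ⟨fun i s hs => ?_, fun v hv => ?_⟩
  · obtain ⟨k, hk⟩ : Z i ∈ Set.range fun i : Fin n =>
        ‖embeddedPoint X i‖⁻¹ • embeddedPoint X i := hZX ▸ Set.mem_range_self i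
    have hk : U (G.graph.connectedComponentMk k) = Z i := (hnormal k).symm.trans hk
    rw [← hk]
    exact hU.exists_isSphereLocalMax_norm_sub_le_radius hpin hg.D_pos hE.le he0 he1 hw₀ hw₁
      G.wMin_le G.le_wMax hclose _ hs
  · obtain ⟨c, s, hs, hcs⟩ := hU.exists_norm_sub_le_radius hpin hg.D_pos hE.le he0 hw₀ hw₁
      G.wMin_le G.le_wMax hclose hv
    obtain ⟨k, hk⟩ := c.nonempty_supp
    have hk : G.graph.connectedComponentMk k = c := hk
    obtain ⟨i, hi⟩ : U c ∈ Set.range Z := by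
      rw [hZX, ← hk, ← hnormal k]
      exact Set.mem_range_self k
    exact ⟨i, s, hs, hi ▸ hcs⟩
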